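/- Let $D_cf(x)=c^{1/2}f(cx)$ for $c>0$ and $T_tf(x)=f(x-t)$ on $L^2(\mathbb R)$, and use the Fourier transform $\hat f(\gamma)=\int f(x)e^{-2\pi i x\gamma}\,dx$. Let $a>1$, $b>0$ and let $\psi\in L^2(\mathbb R)$ be such that the wavelet system $\{D_{a^j}T_{kb}\psi\}_{j,k\in\mathbb Z}$ is a frame for $L^2(\mathbb R)$ with lower frame bound $A>0$. Assume that for some $C>0$, $\sigma>0$, $$|\hat\psi(\gamma)|\le \frac{C}{1+|\gamma|^{1+\sigma}}\quad\text{for a.e. }\gamma\in\mathbb R.$$ For $K\in\mathbb N=\{1,2,\dots\}$ let $\psi_K\in L^2(\mathbb R)$ be given by $\widehat{\psi_K}=\hat\psi\,\chi_{[-K,K]}$, let $$\varepsilon_K=\Big(\frac{K+1/b}{K^{3+2\sigma}}\Big)^{1/2}\,2C\,\Big[\Big(1+\frac1{2\sigma}\Big)\frac{a^{1+\sigma}}{a^{1+\sigma}-1}\Big]^{1/2},$$ and let $N$ be the odd integer with $N-2\le 2bK<N$. Let $\varepsilon>0$. Then: (1) For all sufficiently large $K\in\mathbb N$ one has $$\varepsilon_K<\sqrt{2bA}\quad\text{and}\quad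 \frac{\varepsilon_K}{\sqrt{2bA}-\varepsilon_K}\le\varepsilon.\qquad(*)$$ (2) For every $K\in\mathbb N$ satisfying $(*)$: the odd integer $N$ above exists and is unique; $0<\sum_{k\in\mathbb Z}|\widehat{\psi_K}(a^k\gamma)|^2<\infty$ for a.e. $\gamma$; there is a function $\widetilde{\psi_K}\in L^2(\mathbb R)$ with $$\widehat{\widetilde{\psi_K}}(\gamma)=\frac{b\,\widehat{\psi_K}(\gamma)}{N\sum_{k\in\mathbb Z}|\widehat{\psi_K}(a^k\gamma)|^2}\quad\text{for a.e. }\gamma;$$ the system $\{D_{a^j}T_{kb/N}\widetilde{\psi_K}\}_{j,k\in\mathbb Z}$ is a frame for $L^2(\mathbb R)$, and so is $\{D_{a^j}T_{kb/N}\psi\}_{j,k\in\mathbb Z}$ if $\varepsilon<1$; and the two oversampled systems $\{D_{a^j}T_{kb/N}\psi\}_{j,k\in\mathbb Z}$ and $\{D_{a^j}T_{kb/N}\widetilde{\psi_K}\}_{j,k\in\mathbb Z}$ have bounded synthesis operators $U_N,W_N:\ell^2(\mathbb Z\times\mathbb Z)\to L^2(\mathbb R)$, respectively (where the synthesis operator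 of $\{f_{j,k}\}$ is $(c_{j,k})\mapsto\sum_{j,k}c_{j,k}f_{j,k}$), which satisfy $$\|I-U_NW_N^*\|\le\varepsilon .$$ -/

import Mathlib

open MeasureTheory Filter
open scoped FourierTransform

noncomputable section

namespace OversampledWavelet

/-- The Hilbert space `L²(ℝ)` of complex-valued square-integrable functions. -/
abbrev L2R : Type := Lp (α := ℝ) ℂ 2 (volume : Measure ℝ)

/-- The square-summable complex sequences indexed by `ι`. -/
abbrev ell2 (ι : Type) : Type := lp (fun _ : ι => ℂ) 2

/-! ### Frames and synthesis operators -/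

/-- `f` is a frame with lower frame bound `A` and upper frame bound `B`:
`A ‖x‖² ≤ ∑ |⟨x, f i⟩|² ≤ B ‖x‖²` for all `x`, and `A > 0`. -/
def IsFrameWithBounds {ι H : Type} [NormedAddCommGroup H] [InnerProductSpace ℂ H]
    (f : ι → H) (A B : ℝ) : Prop :=
  0 < A ∧ ∀ x : H, Summable (fun i => ‖inner ℂ (f i) x‖ ^ 2) ∧
    A * ‖x‖ ^ 2 ≤ ∑' i, ‖inner ℂ (f i) x‖ ^ 2 ∧
    ∑' i, ‖inner ℂ (f i) x‖ ^ 2 ≤ B * ‖x‖ ^ 2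

/-- `f` is a frame. -/
def IsFrame {ι H : Type} [NormedAddCommGroup H] [InnerProductSpace ℂ H] (f : ι → H) : Prop :=
  ∃ A B : ℝ, IsFrameWithBounds f A B

/-- `T` is the synthesis operator of `f`: the bounded operator `ℓ²(ι) → H` given by
`T c = ∑ c i • f i`, with unconditional convergence. There is at most one such `T`, and there is
one exactly when `f` is a Bessel sequence. -/
def IsSynthesisOperator {ι H : Type} [NormedAddCommGroup H] [InnerProductSpace ℂ H]
    (f : ι → H) (T : ell2 ι →L[ℂ] H) : Prop :=
  ∀ c : ell2 ι, HasSum (fun i => c i • f i) (T c)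

/-! ### Translation, dilation, wavelet systems -/

theorem memLp_translate (t : ℝ) (f : L2R) : MemLp (fun x : ℝ => f (x - t)) 2 volume :=
  (Lp.memLp f).comp_measurePreserving (measurePreserving_sub_right volume t)

theorem memLp_dilate (c : ℝ) (hc : 0 < c) (f : L2R) :
    MemLp (fun x : ℝ => ((√c : ℝ) : ℂ) * f (c * x)) 2 volume := by
  refine MemLp.const_mul ?_ _
  have hmap : Measure.map (fun x : ℝ => c * x) volume = ENNReal.ofReal |c⁻¹| • volume :=
    Real.map_volume_mul_left hc.ne'
  have h : MemLp f 2 (Measure.map (fun x : ℝ => c * x) volume) := by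
    rw [hmap]
    exact (Lp.memLp f).smul_measure ENNReal.ofReal_ne_top
  exact h.comp_of_map (by fun_prop)

/-- The translation operator `T_t f (x) = f (x - t)`. -/
def translation (t : ℝ) (f : L2R) : L2R := (memLp_translate t f).toLp _

/-- The scaling operator `D_c f (x) = c ^ (1/2) f (c x)`, for `c > 0`. -/
def dilation (c : ℝ) (hc : 0 < c) (f : L2R) : L2R := (memLp_dilate c hc f).toLp _

/-- The wavelet system `{D_{a^j} T_{k b} ψ}`, indexed by `(j, k) ∈ ℤ × ℤ`. -/
def waveletSystem (a : ℝ) (ha : 0 < a) (b : ℝ) (ψ : L2R) (p : ℤ × ℤ) : L2R :=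
  dilation (a ^ p.1) (zpow_pos ha p.1) (translation (p.2 * b) ψ)

/-! ### The truncated generator, the oversampling factor and the error constant -/

/-- The function `ψ_K ∈ L²(ℝ)` whose Fourier transform is that of `ψ` times the indicator
function of `[-K, K]`. -/
def truncation (K : ℝ) (ψ : L2R) : L2R :=
  𝓕⁻ (((Lp.memLp (𝓕 ψ : L2R)).indicator
    (measurableSet_Icc : MeasurableSet (Set.Icc (-K) K))).toLp _ : L2R)

/-- `∑_{k ∈ ℤ} |φ̂ (a^k γ)|²`. -/
def dilationSquareSum (a : ℝ) (φ : L2R) (γ : ℝ) : ℝ :=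
  ∑' k : ℤ, ‖(𝓕 φ : L2R) (a ^ k * γ)‖ ^ 2

/-- The function `b ψ̂_K (γ) / (N ∑_{k ∈ ℤ} |ψ̂_K (a^k γ)|²)`, which is to be the Fourier
transform of the approximately dual generator. -/
def dualGeneratorFourier (a b : ℝ) (N : ℤ) (K : ℝ) (ψ : L2R) (γ : ℝ) : ℂ :=
  (b : ℂ) * (𝓕 (truncation K ψ) : L2R) γ /
    ((N : ℂ) * (dilationSquareSum a (truncation K ψ) γ : ℂ))

/-- `N` is odd and `N - 2 ≤ 2 b K < N`. -/
def IsOversamplingFactor (b : ℝ) (K : ℕ) (N : ℤ) : Prop :=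
  Odd N ∧ (N : ℝ) - 2 ≤ 2 * b * K ∧ 2 * b * K < N

/-- The constant
`ε_K = ((K + 1/b) / K^(3+2σ))^(1/2) * 2 C * ((1 + 1/(2σ)) * a^(1+σ) / (a^(1+σ) - 1))^(1/2)`. -/
def errorConstant (a b C σ : ℝ) (K : ℕ) : ℝ :=
  √(((K : ℝ) + 1 / b) / (K : ℝ) ^ (3 + 2 * σ)) * (2 * C) *
    √((1 + 1 / (2 * σ)) * (a ^ (1 + σ) / (a ^ (1 + σ) - 1)))

end OversampledWavelet

end

/-!
The proof works on the Fourier side, one dilation at a time. By Plancherel, the analysis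
coefficients of `f` at scale `a ^ j` are the Fourier coefficients of the function
`conj (φ̂ (a ^ (-j) ·)) f̂`, periodized with period `a ^ j / β` when the translation step is `β`.
Parseval's identity gives two facts. If that product lives in one period, nothing aliases and the
energy of the scale is exactly `(1 / β) ∫ |φ̂ (a ^ (-j) γ)|² |f̂ γ|² dγ`
(`waveletScale_eq_of_support`). In general, a Cauchy-Schwarz inequality applied pointwise to the
periodization bounds it by `(M / β) ∫ |φ̂ (a ^ (-j) γ)| |f̂ γ|² dγ`, where `M` bounds the sums of
`|φ̂|` over translates of the dual lattice (`waveletScale_le`).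

*Band-limited generators.* Since `2 K < N / b`, no scale of the oversampled system generated by
`ψ_K` aliases. Its frame operator is therefore the Fourier multiplier
`(N / b) ∑_k |ψ̂_K (a ^ k γ)|²`, which is invariant under dilation by `a`. The dual generator
comes from `ψ_K` by the reciprocal multiplier, so reconstruction with `ψ_K` and its dual is exact
(`synthesis_comp_adjoint_dual_eq_id`). Hence `I - U W†` is, up to sign, `G W†`, where `G`
synthesizes the system generated by the tail `ψ - ψ_K`.

*The two norms.* The decay of `ψ̂` turns the second fact into the Bessel bound `N ε_K² / (2 b)` for
the tail system (`frameEnergy_tail_le`). The norm of `W` is governed by a lower bound for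
`∑_k |ψ̂_K (a ^ k γ)|²`. Testing the frame inequality on functions with `f̂ = 1_S`, for `S` in a
short interval `I` away from `0`, gives `b A ≤ ∑_k |ψ̂ (a ^ k γ)|²` almost everywhere
(`le_energyDensity_of_frame`): a scale which aliases on `I` dilates `I` so far out that it only sees
the tail `ψ - ψ_R`, and the contribution of all such scales vanishes as `R → ∞`. Cutting the tail
off again leaves `∑_k |ψ̂_K (a ^ k γ)|² ≥ (√(2 b A) - ε_K)² / 2`
(`dilationSquareSum_truncation_bounds`), and the product of the two norms is at most
`ε_K / (√(2 b A) - ε_K)`.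
-/

noncomputable section

namespace OversampledWavelet

open scoped ENNReal NNReal Topology

/-! ### Bessel sequences and their synthesis operators -/

section Frames

variable {ι H : Type} [NormedAddCommGroup H] [InnerProductSpace ℂ H]

/-- The energy `∑ |⟨f i, x⟩|²` of the frame coefficients of `x`, as an extended nonnegative real,
so that it makes sense before any summability is known. -/
def frameEnergy (f : ι → H) (x : H) : ℝ≥0∞ := ∑' i, ‖inner ℂ (f i) x‖ₑ ^ 2

theorem enorm_sq_eq_ofReal {E : Type*} [SeminormedAddCommGroup E] (x : E) :
    ‖x‖ₑ ^ 2 = ENNReal.ofReal (‖x‖ ^ 2) := by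
  rw [← ofReal_norm, ENNReal.ofReal_pow (norm_nonneg x)]

theorem summable_of_frameEnergy_ne_top {f : ι → H} {x : H} (h : frameEnergy f x ≠ ∞) :
    Summable fun i => ‖inner ℂ (f i) x‖ ^ 2 := by
  have h1 := ENNReal.summable_toReal h
  refine h1.congr fun i => ?_
  simp

theorem frameEnergy_eq_ofReal_tsum {f : ι → H} {x : H}
    (h : Summable fun i => ‖inner ℂ (f i) x‖ ^ 2) :
    frameEnergy f x = ENNReal.ofReal (∑' i, ‖inner ℂ (f i) x‖ ^ 2) := by
  rw [ENNReal.ofReal_tsum_of_nonneg (fun i => by positivity) h]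
  simp only [frameEnergy, enorm_sq_eq_ofReal]

theorem IsFrameWithBounds.frameEnergy_bounds {f : ι → H} {A B : ℝ} (h : IsFrameWithBounds f A B)
    (x : H) : ENNReal.ofReal A * ‖x‖ₑ ^ 2 ≤ frameEnergy f x ∧
      frameEnergy f x ≤ ENNReal.ofReal B * ‖x‖ₑ ^ 2 := by
  obtain ⟨hs, h1, h2⟩ := h.2 x
  rw [frameEnergy_eq_ofReal_tsum hs, enorm_sq_eq_ofReal,
    ← ENNReal.ofReal_mul' (by positivity), ← ENNReal.ofReal_mul' (by positivity)]
  exact ⟨ENNReal.ofReal_le_ofReal h1, ENNReal.ofReal_le_ofReal h2⟩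

theorem isFrameWithBounds_of_frameEnergy_bounds {f : ι → H} {A B : ℝ} (hA : 0 < A) (hB : 0 ≤ B)
    (h1 : ∀ x, ENNReal.ofReal A * ‖x‖ₑ ^ 2 ≤ frameEnergy f x)
    (h2 : ∀ x, frameEnergy f x ≤ ENNReal.ofReal B * ‖x‖ₑ ^ 2) : IsFrameWithBounds f A B := by
  refine ⟨hA, fun x => ?_⟩
  have hs : Summable fun i => ‖inner ℂ (f i) x‖ ^ 2 := by
    refine summable_of_frameEnergy_ne_top ((h2 x).trans_lt ?_).ne
    exact ENNReal.mul_lt_top ENNReal.ofReal_lt_top (by simp)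
  have h1 := h1 x
  have h2 := h2 x
  rw [frameEnergy_eq_ofReal_tsum hs, enorm_sq_eq_ofReal,
    ← ENNReal.ofReal_mul' (by positivity)] at h1 h2
  have h0 : 0 ≤ ∑' i, ‖inner ℂ (f i) x‖ ^ 2 := tsum_nonneg fun i => by positivity
  exact ⟨hs, (ENNReal.ofReal_le_ofReal_iff h0).1 h1,
    (ENNReal.ofReal_le_ofReal_iff (by positivity)).1 h2⟩

variable [CompleteSpace H]

/-- The adjoint of the synthesis operator is the analysis operator. -/
theorem IsSynthesisOperator.adjoint_apply {f : ι → H} {U : ell2 ι →L[ℂ] H}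
    (hU : IsSynthesisOperator f U) (x : H) (i : ι) :
    (ContinuousLinearMap.adjoint U x) i = inner ℂ (f i) x := by
  classical
  have h1 : U (lp.single 2 i (1 : ℂ)) = f i := by
    refine (hU _).unique ?_
    convert hasSum_ite_eq i (f i) using 2 with k
    by_cases hk : k = i
    · subst hk; simp
    · simp [hk]
  rw [← h1, ← ContinuousLinearMap.adjoint_inner_right, lp.inner_single_left]
  simp

theorem IsSynthesisOperator.enorm_adjoint_sq {f : ι → H} {U : ell2 ι →L[ℂ] H}
    (hU : IsSynthesisOperator f U) (x : H) :
    ‖ContinuousLinearMap.adjoint U x‖ₑ ^ 2 = frameEnergy f x := by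
  have h := lp.hasSum_norm (p := 2) (by norm_num) (ContinuousLinearMap.adjoint U x)
  simp only [ENNReal.toReal_ofNat, Real.rpow_ofNat, hU.adjoint_apply] at h
  rw [frameEnergy_eq_ofReal_tsum h.summable, h.tsum_eq, enorm_sq_eq_ofReal]

theorem IsSynthesisOperator.norm_le {f : ι → H} {U : ell2 ι →L[ℂ] H}
    (hU : IsSynthesisOperator f U) {B : ℝ}
    (hf : ∀ x, frameEnergy f x ≤ ENNReal.ofReal B * ‖x‖ₑ ^ 2) : ‖U‖ ≤ √B := by
  rw [← (ContinuousLinearMap.adjoint (𝕜 := ℂ)).norm_map U]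
  refine ContinuousLinearMap.opNorm_le_bound _ (Real.sqrt_nonneg _) fun x => ?_
  have h := hf x
  rw [← hU.enorm_adjoint_sq, enorm_sq_eq_ofReal, enorm_sq_eq_ofReal,
    ← ENNReal.ofReal_mul' (by positivity)] at h
  by_cases hx : ‖x‖ = 0
  · have : x = 0 := norm_eq_zero.1 hx
    simp [this]
  rcases le_or_gt 0 B with hB | hB
  · rw [ENNReal.ofReal_le_ofReal_iff (by positivity)] at h
    refine le_of_sq_le_sq ?_ (by positivity)
    rwa [mul_pow, Real.sq_sqrt hB]
  · rw [ENNReal.ofReal_of_nonpos (p := B * ‖x‖ ^ 2)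
      (mul_nonpos_of_nonpos_of_nonneg hB.le (by positivity))] at h
    have h3 : ‖ContinuousLinearMap.adjoint U x‖ ^ 2 ≤ 0 := by simpa using h
    have h4 : ‖ContinuousLinearMap.adjoint U x‖ = 0 := by
      have := sq_nonneg ‖ContinuousLinearMap.adjoint U x‖
      exact pow_eq_zero_iff two_ne_zero |>.1 (le_antisymm h3 this)
    rw [h4]; positivity

/-- A Bessel sequence has a bounded synthesis operator, namely the adjoint of its analysis
operator. -/
theorem exists_isSynthesisOperator {f : ι → H} {B : ℝ}
    (hf : ∀ x, frameEnergy f x ≤ ENNReal.ofReal B * ‖x‖ₑ ^ 2) :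
    ∃ U : ell2 ι →L[ℂ] H, IsSynthesisOperator f U := by
  classical
  have hs : ∀ x, Summable fun i => ‖inner ℂ (f i) x‖ ^ 2 := fun x =>
    summable_of_frameEnergy_ne_top
      ((hf x).trans_lt (ENNReal.mul_lt_top ENNReal.ofReal_lt_top (by simp))).ne
  have hm : ∀ x, Memℓp (fun i => (inner ℂ (f i) x : ℂ)) 2 := fun x =>
    memℓp_gen (by simpa using hs x)
  let V₀ : H →ₗ[ℂ] ell2 ι :=
    { toFun := fun x => ⟨fun i => inner ℂ (f i) x, hm x⟩
      map_add' := fun x y => Subtype.ext (funext fun i => inner_add_right _ _ _)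
      map_smul' := fun c x => Subtype.ext (funext fun i => inner_smul_right _ _ _) }
  have hV₀ : ∀ x i, V₀ x i = inner ℂ (f i) x := fun _ _ => rfl
  let V : H →L[ℂ] ell2 ι := V₀.mkContinuous (√(max B 0)) fun x => by
    refine le_of_sq_le_sq ?_ (by positivity)
    have h := lp.hasSum_norm (p := 2) (by norm_num) (V₀ x)
    simp only [ENNReal.toReal_ofNat, Real.rpow_ofNat, hV₀] at h
    have h2 := hf x
    rw [frameEnergy_eq_ofReal_tsum (hs x), h.tsum_eq, enorm_sq_eq_ofReal,
      ← ENNReal.ofReal_mul' (by positivity)] at h2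
    rw [mul_pow, Real.sq_sqrt (le_max_right _ _)]
    refine (ENNReal.ofReal_le_ofReal_iff (by positivity)).1 (h2.trans ?_)
    gcongr
    exact le_max_left _ _
  refine ⟨ContinuousLinearMap.adjoint V, fun c => ?_⟩
  have h1 : ∀ i, ContinuousLinearMap.adjoint V (lp.single 2 i (c i)) = c i • f i := fun i => by
    refine ext_inner_right ℂ fun x => ?_
    rw [ContinuousLinearMap.adjoint_inner_left, lp.inner_single_left, inner_smul_left]
    change inner ℂ (c i) (V₀ x i) = _
    rw [hV₀]
    simp [mul_comm]
  have h2 := (lp.hasSum_single (p := 2) (by simp) c).mapL (ContinuousLinearMap.adjoint V)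
  simpa only [h1] using h2

end Frames

/-! ### Pointwise multiplication, translation and dilation on the Fourier side -/

/-- Multiplication by the essentially bounded function `m`, as an operator on `L²(ℝ)`. -/
def mulOperator (m : ℝ → ℂ) (hm : MemLp m ∞ volume) : L2R →L[ℂ] L2R :=
  (ContinuousLinearMap.mul ℂ ℂ).holderL volume ∞ 2 2 hm.toLp

theorem coeFn_mulOperator (m : ℝ → ℂ) (hm : MemLp m ∞ volume) (f : L2R) :
    mulOperator m hm f =ᵐ[volume] fun γ => m γ * f γ := by
  filter_upwards [(ContinuousLinearMap.mul ℂ ℂ).coeFn_holder (r := 2) hm.toLp f,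
    hm.coeFn_toLp] with γ h1 h2
  rw [← h2]
  exact h1

theorem enorm_sq_eq_lintegral (f : L2R) : ‖f‖ₑ ^ 2 = ∫⁻ x, ‖f x‖ₑ ^ 2 := by
  rw [Lp.enorm_def, eLpNorm_eq_lintegral_rpow_enorm_toReal two_ne_zero ENNReal.ofNat_ne_top,
    ← ENNReal.rpow_natCast, ← ENNReal.rpow_mul]
  simp

theorem enorm_sq_eq_lintegral_fourier (f : L2R) : ‖f‖ₑ ^ 2 = ∫⁻ γ, ‖(𝓕 f : L2R) γ‖ₑ ^ 2 := by
  rw [← enorm_sq_eq_lintegral, ← ofReal_norm, ← ofReal_norm, Lp.norm_fourier_eq]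

theorem coeFn_translation (t : ℝ) (f : L2R) : translation t f =ᵐ[volume] fun x => f (x - t) :=
  MemLp.coeFn_toLp _

theorem coeFn_dilation (c : ℝ) (hc : 0 < c) (f : L2R) :
    dilation c hc f =ᵐ[volume] fun x => ((√c : ℝ) : ℂ) * f (c * x) :=
  MemLp.coeFn_toLp _

theorem quasiMeasurePreserving_mul_left {c : ℝ} (hc : c ≠ 0) :
    Measure.QuasiMeasurePreserving (fun x : ℝ => c * x) volume volume := by
  refine ⟨by fun_prop, ?_⟩
  rw [Real.map_volume_mul_left hc]
  exact Measure.smul_absolutelyContinuous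

theorem lintegral_comp_mul_left {c : ℝ} (hc : c ≠ 0) {f : ℝ → ℝ≥0∞} :
    ∫⁻ x, f (c * x) = ENNReal.ofReal |c⁻¹| * ∫⁻ x, f x := by
  have h : MeasurableEmbedding (fun x : ℝ => c * x) :=
    (Homeomorph.mulLeft₀ c hc).measurableEmbedding
  rw [← h.lintegral_map, Real.map_volume_mul_left hc, lintegral_smul_measure, smul_eq_mul]

theorem continuous_translation (t : ℝ) : Continuous (translation t) := by
  have h : translation t = Lp.compMeasurePreserving (fun x : ℝ => x - t)
      (measurePreserving_sub_right volume t) (E := ℂ) (p := 2) := by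
    ext1 f
    refine Lp.ext ?_
    filter_upwards [coeFn_translation t f, Lp.coeFn_compMeasurePreserving f
      (measurePreserving_sub_right volume t)] with x h1 h2
    rw [h1, h2]; rfl
  rw [h]
  exact (Lp.isometry_compMeasurePreserving (measurePreserving_sub_right volume t)).continuous

theorem dilation_sub (c : ℝ) (hc : 0 < c) (f g : L2R) :
    dilation c hc (f - g) = dilation c hc f - dilation c hc g := by
  refine Lp.ext ?_
  filter_upwards [coeFn_dilation c hc (f - g), coeFn_dilation c hc f, coeFn_dilation c hc g,
    Lp.coeFn_sub (dilation c hc f) (dilation c hc g),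
    (quasiMeasurePreserving_mul_left hc.ne').ae (Lp.coeFn_sub f g)] with x h1 h2 h3 h4 h5
  rw [h1, h4, Pi.sub_apply, h2, h3, h5, Pi.sub_apply, mul_sub]

theorem enorm_dilation_sq (c : ℝ) (hc : 0 < c) (f : L2R) : ‖dilation c hc f‖ₑ ^ 2 = ‖f‖ₑ ^ 2 := by
  have h1 : ∀ᵐ x, ‖dilation c hc f x‖ₑ ^ 2 = ENNReal.ofReal c * ‖f (c * x)‖ₑ ^ 2 := by
    filter_upwards [coeFn_dilation c hc f] with x hx
    rw [hx, enorm_mul, mul_pow, enorm_sq_eq_ofReal ((√c : ℝ) : ℂ)]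
    simp [Real.sq_sqrt hc.le]
  rw [enorm_sq_eq_lintegral, enorm_sq_eq_lintegral, lintegral_congr_ae h1,
    lintegral_const_mul' _ _ ENNReal.ofReal_ne_top,
    lintegral_comp_mul_left hc.ne' (f := fun x => ‖f x‖ₑ ^ 2), ← mul_assoc,
    ← ENNReal.ofReal_mul hc.le, abs_of_pos (inv_pos.2 hc), mul_inv_cancel₀ hc.ne']
  simp

theorem continuous_dilation (c : ℝ) (hc : 0 < c) : Continuous (dilation c hc) := by
  refine (Isometry.of_dist_eq fun f g => ?_).continuous
  rw [dist_eq_norm, dist_eq_norm, ← dilation_sub]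
  have h := enorm_dilation_sq c hc (f - g)
  rw [enorm_sq_eq_ofReal, enorm_sq_eq_ofReal,
    ENNReal.ofReal_eq_ofReal_iff (by positivity) (by positivity)] at h
  exact (pow_left_inj₀ (norm_nonneg _) (norm_nonneg _) two_ne_zero).1 h

/-- Two continuous maps on `L²(ℝ)` that agree on the Schwartz functions are equal. -/
theorem eq_of_eq_on_schwartz {S T : L2R → L2R} (hS : Continuous S) (hT : Continuous T)
    (h : ∀ φ : SchwartzMap ℝ ℂ, S (φ.toLp 2) = T (φ.toLp 2)) (f : L2R) : S f = T f := by
  have hd : DenseRange (SchwartzMap.toLpCLM ℝ ℂ 2 (volume : Measure ℝ)) :=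
    SchwartzMap.denseRange_toLpCLM (by simp)
  exact congrFun (hd.equalizer hS hT (funext h)) f

/-- The phase `exp (-2 π i t γ)` by which a translation by `t` acts on the Fourier side. -/
def phase (t γ : ℝ) : ℂ := Complex.exp (-(2 * Real.pi * t * γ * Complex.I))

theorem continuous_phase (t : ℝ) : Continuous (phase t) := by
  unfold phase; fun_prop

theorem norm_phase (t γ : ℝ) : ‖phase t γ‖ = 1 := by
  have : -(2 * Real.pi * t * γ * Complex.I : ℂ) =
      ((-(2 * Real.pi * t * γ) : ℝ) : ℂ) * Complex.I := by
    push_cast; ring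
  rw [phase, this, Complex.norm_exp_ofReal_mul_I]

theorem memLp_phase (t : ℝ) : MemLp (phase t) ∞ volume :=
  memLp_top_of_bound (continuous_phase t).aestronglyMeasurable 1
    (Eventually.of_forall fun γ => (norm_phase t γ).le)

theorem continuous_fourier_L2 : Continuous (fun f : L2R => (𝓕 f : L2R)) :=
  (Lp.fourierTransformₗᵢ ℝ ℂ).continuous

theorem fourier_translation (t : ℝ) (f : L2R) :
    (𝓕 (translation t f) : L2R) =ᵐ[volume] fun γ => phase t γ * (𝓕 f : L2R) γ := by
  have key : (𝓕 (translation t f) : L2R) = mulOperator (phase t) (memLp_phase t) (𝓕 f : L2R) := by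
    refine eq_of_eq_on_schwartz (S := fun f => (𝓕 (translation t f) : L2R))
      (T := fun f => mulOperator (phase t) (memLp_phase t) (𝓕 f : L2R))
      (continuous_fourier_L2.comp (continuous_translation t))
      ((mulOperator _ _).continuous.comp continuous_fourier_L2) (fun φ => ?_) f
    have h1 : translation t (φ.toLp 2) = (SchwartzMap.compSubConstCLM ℂ t φ).toLp 2 := by
      refine Lp.ext ?_
      filter_upwards [coeFn_translation t (φ.toLp 2),
        (measurePreserving_sub_right volume t).quasiMeasurePreserving.ae (φ.coeFn_toLp 2 volume),
        (SchwartzMap.compSubConstCLM ℂ t φ).coeFn_toLp 2 volume] with x h1 h2 h3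
      rw [h1, h2, h3]; rfl
    rw [h1, SchwartzMap.toLp_fourier_eq, SchwartzMap.toLp_fourier_eq]
    refine Lp.ext ?_
    filter_upwards [coeFn_mulOperator (phase t) (memLp_phase t) ((𝓕 φ).toLp 2),
      (𝓕 φ).coeFn_toLp 2 volume,
      (𝓕 (SchwartzMap.compSubConstCLM ℂ t φ)).coeFn_toLp 2 volume] with γ h1 h2 h3
    rw [h1, h2, h3, SchwartzMap.fourier_coe, SchwartzMap.fourier_coe, Real.fourier_eq',
      Real.fourier_eq', ← integral_const_mul,
      ← integral_sub_right_eq_self (fun v => phase t γ * _) t]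
    refine integral_congr_ae (Eventually.of_forall fun x => ?_)
    simp only [SchwartzMap.compSubConstCLM_apply, smul_eq_mul, ← mul_assoc, phase,
      ← Complex.exp_add]
    congr 2
    simp
    ring
  rw [key]
  exact coeFn_mulOperator _ _ _

/-- The Fourier transform intertwines dilation by `c` with dilation by `c⁻¹`. -/
theorem fourier_dilation (c : ℝ) (hc : 0 < c) (f : L2R) :
    (𝓕 (dilation c hc f) : L2R) = dilation c⁻¹ (inv_pos.2 hc) (𝓕 f : L2R) := by
  refine eq_of_eq_on_schwartz (S := fun f => (𝓕 (dilation c hc f) : L2R))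
    (T := fun f => dilation c⁻¹ (inv_pos.2 hc) (𝓕 f : L2R))
    (continuous_fourier_L2.comp (continuous_dilation c hc))
    ((continuous_dilation _ _).comp continuous_fourier_L2) (fun φ => ?_) f
  let e : ℝ ≃L[ℝ] ℝ := ContinuousLinearEquiv.unitsEquivAut ℝ (Units.mk0 c hc.ne')
  have he : ∀ x, e x = c * x := fun x => by
    simp [e, ContinuousLinearEquiv.unitsEquivAut, mul_comm]
  let φc : SchwartzMap ℝ ℂ :=
    ((√c : ℝ) : ℂ) • SchwartzMap.compCLMOfContinuousLinearEquiv ℂ e φ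
  have hφc : ∀ x, φc x = ((√c : ℝ) : ℂ) * φ (c * x) := fun x => by
    simp [φc, he]
  have h1 : dilation c hc (φ.toLp 2) = φc.toLp 2 := by
    refine Lp.ext ?_
    filter_upwards [coeFn_dilation c hc (φ.toLp 2),
      (quasiMeasurePreserving_mul_left hc.ne').ae (φ.coeFn_toLp 2 volume),
      φc.coeFn_toLp 2 volume] with x h1 h2 h3
    rw [h1, h2, h3, hφc]
  rw [h1, SchwartzMap.toLp_fourier_eq, SchwartzMap.toLp_fourier_eq]
  refine Lp.ext ?_
  filter_upwards [coeFn_dilation c⁻¹ (inv_pos.2 hc) ((𝓕 φ).toLp 2),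
    (quasiMeasurePreserving_mul_left (inv_ne_zero hc.ne')).ae ((𝓕 φ).coeFn_toLp 2 volume),
    (𝓕 φc).coeFn_toLp 2 volume] with γ h1 h2 h3
  rw [h1, h2, h3, SchwartzMap.fourier_coe, SchwartzMap.fourier_coe, Real.fourier_eq',
    Real.fourier_eq']
  have h4 := Measure.integral_comp_mul_left (fun v : ℝ =>
    Complex.exp (((-2 * Real.pi * inner ℝ v (c⁻¹ * γ) : ℝ) : ℂ) * Complex.I) • φ v) c
  have h5 : ∀ x : ℝ, inner ℝ (c * x) (c⁻¹ * γ) = inner ℝ x γ := fun x => by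
    simp; field_simp
  have h6 : ((√c⁻¹ : ℝ) : ℂ) = ((√c : ℝ) : ℂ) * ((|c⁻¹| : ℝ) : ℂ) := by
    rw [← Complex.ofReal_mul, abs_of_pos (inv_pos.2 hc), Real.sqrt_inv, ← div_eq_mul_inv,
      Real.sqrt_div_self']
    simp
  simp only [h5] at h4
  rw [h6, mul_assoc, ← Complex.real_smul (x := |c⁻¹|), ← h4, ← integral_const_mul]
  refine integral_congr_ae (Eventually.of_forall fun x => ?_)
  simp only [hφc, smul_eq_mul]
  ring

/-- The energy at a single scale, on the Fourier side: `H` is the dilated generator, `f` the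
analysed function, and `T` is the period dual to the translation step. -/
def scaleEnergy (T : ℝ) (H f : ℝ → ℂ) : ℝ≥0∞ :=
  ∑' k : ℤ, ‖∫ γ : ℝ, Complex.exp (2 * Real.pi * Complex.I * k * γ / T) *
    (starRingEnd ℂ (H γ) * f γ)‖ₑ ^ 2

theorem fourier_waveletSystem (a : ℝ) (ha : 0 < a) (β : ℝ) (φ : L2R) (j k : ℤ) :
    (𝓕 (waveletSystem a ha β φ (j, k)) : L2R) =ᵐ[volume] fun γ =>
      ((√(a ^ j)⁻¹ : ℝ) : ℂ) * (phase (k * β) ((a ^ j)⁻¹ * γ) * (𝓕 φ : L2R) ((a ^ j)⁻¹ * γ)) := by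
  rw [waveletSystem, fourier_dilation]
  filter_upwards [coeFn_dilation (a ^ j)⁻¹ (inv_pos.2 (zpow_pos ha j))
    (𝓕 (translation (k * β) φ) : L2R),
    (quasiMeasurePreserving_mul_left (inv_ne_zero (zpow_pos ha j).ne')).ae
      (fourier_translation (k * β) φ)] with γ h1 h2
  rw [h1, h2]

/-- On the Fourier side, the energy of a wavelet system splits into the energies of its scales:
at scale `a ^ j` the translation step is `β a ^ (-j)`, so the dual period is `a ^ j / β`. -/
theorem frameEnergy_waveletSystem (a : ℝ) (ha : 0 < a) {β : ℝ} (φ f : L2R) :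
    frameEnergy (waveletSystem a ha β φ) f = ∑' j : ℤ, ENNReal.ofReal (a ^ j)⁻¹ *
      scaleEnergy (a ^ j / β) (fun γ => (𝓕 φ : L2R) ((a ^ j)⁻¹ * γ)) (𝓕 f : L2R) := by
  rw [frameEnergy, ENNReal.tsum_prod']
  refine tsum_congr fun j => ?_
  rw [scaleEnergy, ← ENNReal.tsum_mul_left]
  refine tsum_congr fun k => ?_
  have haj := inv_pos.2 (zpow_pos ha j)
  rw [← Lp.inner_fourier_eq, L2.inner_def]
  have h1 : ∫ γ, inner ℂ ((𝓕 (waveletSystem a ha β φ (j, k)) : L2R) γ) ((𝓕 f : L2R) γ) =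
      ((√(a ^ j)⁻¹ : ℝ) : ℂ) * ∫ γ : ℝ,
        Complex.exp (2 * Real.pi * Complex.I * k * γ / ((a ^ j / β : ℝ) : ℂ)) *
        (starRingEnd ℂ ((𝓕 φ : L2R) ((a ^ j)⁻¹ * γ)) * (𝓕 f : L2R) γ) := by
    rw [← integral_const_mul]
    refine integral_congr_ae ?_
    filter_upwards [fourier_waveletSystem a ha β φ j k] with γ hγ
    have h2 : starRingEnd ℂ (phase (k * β) ((a ^ j)⁻¹ * γ)) =
        Complex.exp (2 * Real.pi * Complex.I * k * γ / ((a ^ j / β : ℝ) : ℂ)) := by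
      rw [phase, ← Complex.exp_conj]
      congr 1
      have h3 : starRingEnd ℂ 2 = 2 := map_ofNat _ 2
      simp [h3]
      field_simp
    rw [hγ, RCLike.inner_apply, map_mul, map_mul, h2, Complex.conj_ofReal]
    ring
  rw [h1, enorm_mul, mul_pow, enorm_sq_eq_ofReal ((√(a ^ j)⁻¹ : ℝ) : ℂ)]
  congr 2
  rw [Complex.norm_real, Real.norm_of_nonneg (Real.sqrt_nonneg _), Real.sq_sqrt haj.le]

/-! ### The energy at a single scale -/

/-- Parseval's identity on a period. -/
theorem tsum_enorm_setIntegral_exp_sq {T : ℝ} (hT : 0 < T) (x : ℝ) {P : ℝ → ℂ}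
    (hP : MemLp P 2 (volume.restrict (Set.Ioc x (x + T)))) :
    ∑' k : ℤ, ‖∫ γ : ℝ in Set.Ioc x (x + T),
        Complex.exp (2 * Real.pi * Complex.I * k * γ / T) * P γ‖ₑ ^ 2 =
      ENNReal.ofReal T * ∫⁻ γ in Set.Ioc x (x + T), ‖P γ‖ₑ ^ 2 := by
  have hlt : x < x + T := by linarith
  have h := hasSum_sq_fourierCoeffOn hlt hP
  have hTT : x + T - x = T := by ring
  have h1 : ∀ n : ℤ, fourierCoeffOn hlt P n = (T⁻¹ : ℝ) • ∫ γ : ℝ in Set.Ioc x (x + T),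
      Complex.exp (2 * Real.pi * Complex.I * (-n : ℤ) * γ / T) * P γ := fun n => by
    rw [fourierCoeffOn_eq_integral, intervalIntegral.integral_of_le hlt.le]
    simp only [fourier_coe_apply, hTT, one_div, smul_eq_mul]
  have h2 := h.mul_left (T ^ 2)
  have h3 : ∀ n : ℤ, T ^ 2 * ‖fourierCoeffOn hlt P n‖ ^ 2 =
      ‖∫ γ : ℝ in Set.Ioc x (x + T),
        Complex.exp (2 * Real.pi * Complex.I * (-n : ℤ) * γ / T) * P γ‖ ^ 2 := fun n => by
    rw [h1, norm_smul, mul_pow, Real.norm_of_nonneg (inv_nonneg.2 hT.le), ← mul_assoc, ← mul_pow,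
      mul_inv_cancel₀ hT.ne', one_pow, one_mul]
  simp only [h3] at h2
  have h4 : ∑' k : ℤ, ‖∫ γ : ℝ in Set.Ioc x (x + T),
        Complex.exp (2 * Real.pi * Complex.I * k * γ / T) * P γ‖ₑ ^ 2 =
      ∑' k : ℤ, ENNReal.ofReal (‖∫ γ : ℝ in Set.Ioc x (x + T),
        Complex.exp (2 * Real.pi * Complex.I * (-k : ℤ) * γ / T) * P γ‖ ^ 2) := by
    rw [← (Equiv.neg ℤ).tsum_eq]
    exact tsum_congr fun k => enorm_sq_eq_ofReal _
  rw [h4, ← ENNReal.ofReal_tsum_of_nonneg (fun k => by positivity) h2.summable, h2.tsum_eq, hTT,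
    intervalIntegral.integral_of_le hlt.le, smul_eq_mul, ← mul_assoc,
    ENNReal.ofReal_mul (by positivity)]
  congr 1
  · congr 1; field_simp
  · rw [ofReal_integral_eq_lintegral_ofReal ((memLp_two_iff_integrable_sq_norm hP.1).1 hP)
      (Eventually.of_forall fun _ => by positivity)]
    exact lintegral_congr fun γ => (enorm_sq_eq_ofReal _).symm

/-- If the product of the dilated generator `H` with `f` lives in one period, then the frequencies
do not alias, and the energy of the scale is exactly a weighted norm of `f`. -/
theorem scaleEnergy_eq_of_support {T : ℝ} (hT : 0 < T) (x : ℝ) {H f : ℝ → ℂ}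
    (hH : MemLp H ∞ volume) (hf : MemLp f 2 volume)
    (hs : ∀ᵐ γ, γ ∉ Set.Ioc x (x + T) → starRingEnd ℂ (H γ) * f γ = 0) :
    scaleEnergy T H f = ENNReal.ofReal T * ∫⁻ γ, ‖H γ‖ₑ ^ 2 * ‖f γ‖ₑ ^ 2 := by
  have hP : MemLp (fun γ => starRingEnd ℂ (H γ) * f γ) 2 volume :=
    hf.mul (hH.star)
  have h1 : ∀ k : ℤ, ∫ γ : ℝ, Complex.exp (2 * Real.pi * Complex.I * k * γ / T) *
      (starRingEnd ℂ (H γ) * f γ) = ∫ γ : ℝ in Set.Ioc x (x + T),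
        Complex.exp (2 * Real.pi * Complex.I * k * γ / T) * (starRingEnd ℂ (H γ) * f γ) :=
    fun k => by
      refine (setIntegral_eq_integral_of_ae_compl_eq_zero ?_).symm
      filter_upwards [hs] with γ hγ hmem
      rw [hγ hmem, mul_zero]
  simp only [scaleEnergy, h1]
  rw [tsum_enorm_setIntegral_exp_sq hT x (hP.restrict _)]
  congr 1
  have h2 : ∀ γ, ‖starRingEnd ℂ (H γ) * f γ‖ₑ ^ 2 = ‖H γ‖ₑ ^ 2 * ‖f γ‖ₑ ^ 2 := fun γ => by
    rw [enorm_mul, mul_pow, RCLike.enorm_conj]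
  simp only [h2]
  rw [← lintegral_add_compl (μ := volume) (fun γ => ‖H γ‖ₑ ^ 2 * ‖f γ‖ₑ ^ 2)
    (measurableSet_Ioc : MeasurableSet (Set.Ioc x (x + T)))]
  have h3 : ∫⁻ γ in (Set.Ioc x (x + T))ᶜ, ‖H γ‖ₑ ^ 2 * ‖f γ‖ₑ ^ 2 = 0 := by
    refine (setLIntegral_congr_fun_ae measurableSet_Ioc.compl ?_).trans lintegral_zero
    filter_upwards [hs] with γ hγ hmem
    rw [← h2, hγ hmem]
    simp
  rw [h3, add_zero]

/-- The Cauchy-Schwarz inequality with weights `h`. -/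
theorem tsum_mul_sq_le (h g : ℤ → ℝ≥0∞) :
    (∑' n, h n * g n) ^ 2 ≤ (∑' n, h n) * ∑' n, h n * g n ^ 2 := by
  have hm : ∀ u : ℤ → ℝ≥0∞, AEMeasurable u Measure.count := fun u =>
    (measurable_of_countable u).aemeasurable
  have key := ENNReal.lintegral_mul_norm_pow_le (μ := Measure.count) (hm h)
    (hm fun n => h n * g n ^ 2) (p := 1 / 2) (q := 1 / 2) (by norm_num) (by norm_num) (by norm_num)
  have h1 : ∀ n, h n ^ (1 / 2 : ℝ) * (h n * g n ^ 2) ^ (1 / 2 : ℝ) = h n * g n := fun n => by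
    rw [ENNReal.mul_rpow_of_nonneg _ _ (by norm_num), ← mul_assoc,
      ← ENNReal.rpow_add_of_nonneg _ _ (by norm_num) (by norm_num), ← ENNReal.rpow_natCast,
      ← ENNReal.rpow_mul]
    norm_num
  simp only [h1, lintegral_count] at key
  calc (∑' n, h n * g n) ^ 2 ≤ ((∑' n, h n) ^ (1 / 2 : ℝ) *
        (∑' n, h n * g n ^ 2) ^ (1 / 2 : ℝ)) ^ 2 := by gcongr
    _ = _ := by
      rw [mul_pow, ← ENNReal.rpow_natCast, ← ENNReal.rpow_natCast, ← ENNReal.rpow_mul,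
        ← ENNReal.rpow_mul]
      norm_num

/-- The integers are in bijection with the multiples of `T ≠ 0`. -/
def intEquivZmultiples {T : ℝ} (hT : 0 < T) : ℤ ≃ AddSubgroup.zmultiples T :=
  Equiv.ofBijective (fun n : ℤ => ⟨n • T, n, rfl⟩)
    ⟨fun _ _ h => (zsmul_left_strictMono hT).injective (congrArg Subtype.val h),
      fun ⟨_, n, hn⟩ => ⟨n, Subtype.ext hn⟩⟩

theorem lintegral_eq_tsum_period {T : ℝ} (hT : 0 < T) (f : ℝ → ℝ≥0∞) :
    ∫⁻ γ, f γ = ∑' n : ℤ, ∫⁻ γ in Set.Ioc 0 (0 + T), f (n * T + γ) := by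
  have h := (isAddFundamentalDomain_Ioc hT 0 volume).lintegral_eq_tsum'' f
  rw [h, ← (intEquivZmultiples hT).tsum_eq]
  refine tsum_congr fun n => lintegral_congr fun γ => ?_
  simp [intEquivZmultiples, AddSubgroup.vadd_def]

theorem integral_eq_tsum_period {T : ℝ} (hT : 0 < T) (f : ℝ → ℂ) (hf : Integrable f) :
    ∫ γ, f γ = ∑' n : ℤ, ∫ γ in Set.Ioc 0 (0 + T), f (n * T + γ) := by
  have h := (isAddFundamentalDomain_Ioc hT 0 volume).integral_eq_tsum'' f hf
  rw [h, ← (intEquivZmultiples hT).tsum_eq]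
  refine tsum_congr fun n => integral_congr_ae (Eventually.of_forall fun γ => ?_)
  simp [intEquivZmultiples, AddSubgroup.vadd_def]

theorem exp_periodic {T : ℝ} (hT : 0 < T) (k n : ℤ) (γ : ℝ) :
    Complex.exp (2 * Real.pi * Complex.I * k * ((n * T + γ : ℝ) : ℂ) / T) =
      Complex.exp (2 * Real.pi * Complex.I * k * γ / T) := by
  have hT' : (T : ℂ) ≠ 0 := by exact_mod_cast hT.ne'
  have : (2 * Real.pi * Complex.I * k * ((n * T + γ : ℝ) : ℂ) / T : ℂ) =
      2 * Real.pi * Complex.I * k * γ / T + (k * n : ℤ) * (2 * Real.pi * Complex.I) := by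
    push_cast; field_simp; ring
  rw [this, Complex.exp_periodic.int_mul _ _]

theorem norm_exp_two_pi (k : ℤ) (γ T : ℝ) :
    ‖Complex.exp (2 * Real.pi * Complex.I * k * γ / T)‖ = 1 := by
  have : (2 * Real.pi * Complex.I * k * γ / T : ℂ) = ((2 * Real.pi * k * γ / T : ℝ) : ℂ) *
      Complex.I := by push_cast; ring
  rw [this, Complex.norm_exp_ofReal_mul_I]

/-- A bound for the energy of a scale that also holds when frequencies alias: apply the
Cauchy-Schwarz inequality to the `T`-periodization of `conj H * f`, pointwise and with weights
`|H|`. -/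
theorem scaleEnergy_le {T : ℝ} (hT : 0 < T) {H f : ℝ → ℂ} {M : ℝ≥0∞} (hM : M ≠ ∞)
    (hH : MemLp H 2 volume) (hf : MemLp f 2 volume)
    (hs : ∀ᵐ γ : ℝ, ∑' n : ℤ, ‖H (n * T + γ)‖ₑ ≤ M) :
    scaleEnergy T H f ≤ ENNReal.ofReal T * (M * ∫⁻ γ, ‖H γ‖ₑ * ‖f γ‖ₑ ^ 2) := by
  set F : ℝ → ℂ := fun γ => starRingEnd ℂ (H γ) * f γ with hF
  set I : Set ℝ := Set.Ioc 0 (0 + T) with hI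
  have hFint : Integrable F := MemLp.integrable_mul hH.star hf
  have htr : ∀ n : ℤ, MeasurePreserving (fun γ : ℝ => n * T + γ) volume volume := fun n =>
    measurePreserving_add_left volume _
  have hFn : ∀ n : ℤ, Integrable (fun γ => F (n * T + γ)) := fun n =>
    (htr n).integrable_comp_of_integrable hFint
  have hsum : ∑' n : ℤ, ∫⁻ γ in I, ‖F (n * T + γ)‖ₑ ≠ ∞ := by
    rw [← lintegral_eq_tsum_period hT (fun γ => ‖F γ‖ₑ)]
    exact hFint.2.ne
  set P : ℝ → ℂ := fun γ => ∑' n : ℤ, F (n * T + γ) with hP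
  have hae : ∀ᵐ γ ∂(volume.restrict I), Summable fun n : ℤ => F (n * T + γ) := by
    rw [← lintegral_tsum fun n => (hFn n).1.restrict.enorm] at hsum
    filter_upwards [ae_lt_top' (AEMeasurable.tsum fun n => (hFn n).1.restrict.enorm) hsum]
      with γ hγ
    refine Summable.of_norm ?_
    have := ENNReal.summable_toReal hγ.ne
    simpa using this
  have hPm : AEStronglyMeasurable P (volume.restrict I) := by
    refine aestronglyMeasurable_of_tendsto_ae (atTop : Filter (Finset ℤ))
      (f := fun s γ => ∑ n ∈ s, F (n * T + γ)) (fun s => ?_) ?_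
    · exact Finset.aestronglyMeasurable_fun_sum s fun n _ => (hFn n).1.restrict
    · filter_upwards [hae] with γ hγ using hγ.hasSum
  have hPle : ∀ᵐ γ ∂(volume.restrict I),
      ‖P γ‖ₑ ^ 2 ≤ M * ∑' n : ℤ, ‖H (n * T + γ)‖ₑ * ‖f (n * T + γ)‖ₑ ^ 2 := by
    filter_upwards [ae_restrict_of_ae hs] with γ hγ
    calc ‖P γ‖ₑ ^ 2 ≤ (∑' n : ℤ, ‖H (n * T + γ)‖ₑ * ‖f (n * T + γ)‖ₑ) ^ 2 := by
          gcongr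
          refine (enorm_tsum_le_tsum_enorm).trans_eq (tsum_congr fun n => ?_)
          rw [hF, enorm_mul, RCLike.enorm_conj]
      _ ≤ _ := (tsum_mul_sq_le _ _).trans (by gcongr)
  have hmeas : AEMeasurable (fun γ => ‖H γ‖ₑ * ‖f γ‖ₑ ^ 2) :=
    hH.1.enorm.mul (hf.1.enorm.pow_const 2)
  have hPint : ∫⁻ γ in I, ‖P γ‖ₑ ^ 2 ≤ M * ∫⁻ γ, ‖H γ‖ₑ * ‖f γ‖ₑ ^ 2 := by
    refine (lintegral_mono_ae hPle).trans_eq ?_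
    have h1 : ∫⁻ γ in I, ∑' n : ℤ, ‖H (n * T + γ)‖ₑ * ‖f (n * T + γ)‖ₑ ^ 2 =
        ∑' n : ℤ, ∫⁻ γ in I, ‖H (n * T + γ)‖ₑ * ‖f (n * T + γ)‖ₑ ^ 2 :=
      lintegral_tsum fun n =>
        (hmeas.comp_quasiMeasurePreserving (htr n).quasiMeasurePreserving).restrict
    rw [lintegral_const_mul' _ _ hM, h1,
      lintegral_eq_tsum_period hT (fun γ => ‖H γ‖ₑ * ‖f γ‖ₑ ^ 2)]
  -- one term of the sum bounding `H` shows that `H` is bounded, so the right side is finite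
  have hfin : ∫⁻ γ, ‖H γ‖ₑ * ‖f γ‖ₑ ^ 2 ≠ ∞ := by
    have h1 : ∫⁻ γ, ‖H γ‖ₑ * ‖f γ‖ₑ ^ 2 ≤ ∫⁻ γ, M * ‖f γ‖ₑ ^ 2 := by
      refine lintegral_mono_ae ?_
      filter_upwards [hs] with γ hγ
      gcongr
      have := (ENNReal.le_tsum (f := fun n : ℤ => ‖H (n * T + γ)‖ₑ) 0).trans hγ
      simpa using this
    refine (h1.trans_lt ?_).ne
    rw [lintegral_const_mul' _ _ hM]
    refine ENNReal.mul_lt_top hM.lt_top ?_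
    have h2 := hf.integrable_norm_pow (p := 2) two_ne_zero
    have h3 := h2.2
    simpa [HasFiniteIntegral] using h3
  have hP2 : MemLp P 2 (volume.restrict I) := by
    refine ⟨hPm, ?_⟩
    rw [eLpNorm_lt_top_iff_lintegral_rpow_enorm_lt_top two_ne_zero ENNReal.ofNat_ne_top]
    simp only [ENNReal.toReal_ofNat, ENNReal.rpow_ofNat]
    exact hPint.trans_lt (ENNReal.mul_lt_top hM.lt_top hfin.lt_top)
  -- unfolding: integrating `F` against an exponential is integrating `P` over one period
  have hcoef : ∀ k : ℤ, ∫ γ : ℝ, Complex.exp (2 * Real.pi * Complex.I * k * γ / T) * F γ =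
      ∫ γ : ℝ in I, Complex.exp (2 * Real.pi * Complex.I * k * γ / T) * P γ := fun k => by
    have hcont : Continuous fun γ : ℝ => Complex.exp (2 * Real.pi * Complex.I * k * γ / T) := by
      fun_prop
    rw [integral_eq_tsum_period hT _ (hFint.bdd_mul (c := 1) hcont.aestronglyMeasurable
      (Eventually.of_forall fun γ => (norm_exp_two_pi k γ T).le))]
    simp only [exp_periodic hT, hP, ← tsum_mul_left]
    refine (integral_tsum (fun n => (hcont.aestronglyMeasurable.mul (hFn n).1).restrict) ?_).symm
    have h1 : ∀ γ : ℝ, ‖Complex.exp (2 * Real.pi * Complex.I * k * γ / T)‖ₑ = 1 := fun γ => by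
      rw [← ofReal_norm, norm_exp_two_pi]; simp
    simpa only [Pi.mul_apply, enorm_mul, h1, one_mul] using hsum
  simp only [scaleEnergy]
  simp only [hF] at hcoef
  simp only [hcoef]
  rw [tsum_enorm_setIntegral_exp_sq hT 0 hP2]
  gcongr

/-! ### The energy of a wavelet system -/

theorem memLp_comp_mul_left {c : ℝ} (hc : c ≠ 0) {f : ℝ → ℂ} {p : ℝ≥0∞}
    (hf : MemLp f p volume) : MemLp (fun γ => f (c * γ)) p volume := by
  refine MemLp.comp_of_map (f := fun γ : ℝ => c * γ) ?_ (by fun_prop)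
  rw [Real.map_volume_mul_left hc]
  exact hf.smul_measure ENNReal.ofReal_ne_top

theorem measurable_fourier (φ : L2R) : Measurable ((𝓕 φ : L2R) : ℝ → ℂ) :=
  (Lp.stronglyMeasurable _).measurable

/-- The sum `∑_j |φ̂ (a ^ (-j) γ)|²` as an extended nonnegative real. -/
def energyDensity (a : ℝ) (φ : L2R) (γ : ℝ) : ℝ≥0∞ :=
  ∑' j : ℤ, ‖(𝓕 φ : L2R) ((a ^ j)⁻¹ * γ)‖ₑ ^ 2

theorem measurable_energyDensity (a : ℝ) (φ : L2R) : Measurable (energyDensity a φ) := by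
  have := measurable_fourier φ
  exact Measurable.tsum fun j => by fun_prop

/-- A scale that does not alias on the spectrum of `f` contributes a weighted norm of `f`. -/
theorem waveletScale_eq_of_support {a : ℝ} (ha : 0 < a) {β : ℝ} (hβ : 0 < β) (φ : L2R) (j : ℤ)
    (hφ : MemLp (𝓕 φ : L2R) ∞ volume) (x : ℝ) (f : L2R)
    (hs : ∀ᵐ γ : ℝ, γ ∉ Set.Ioc x (x + a ^ j / β) →
      (𝓕 φ : L2R) ((a ^ j)⁻¹ * γ) = 0 ∨ (𝓕 f : L2R) γ = 0) :
    ENNReal.ofReal (a ^ j)⁻¹ *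
      scaleEnergy (a ^ j / β) (fun γ => (𝓕 φ : L2R) ((a ^ j)⁻¹ * γ)) (𝓕 f : L2R) =
    ENNReal.ofReal (1 / β) *
      ∫⁻ γ, ‖(𝓕 φ : L2R) ((a ^ j)⁻¹ * γ)‖ₑ ^ 2 * ‖(𝓕 f : L2R) γ‖ₑ ^ 2 := by
  have haj := zpow_pos ha j
  rw [scaleEnergy_eq_of_support (by positivity) x (memLp_comp_mul_left (inv_pos.2 haj).ne' hφ)
    (Lp.memLp _), ← mul_assoc, ← ENNReal.ofReal_mul (inv_pos.2 haj).le]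
  · congr 2
    field_simp
  · filter_upwards [hs] with γ hγ hmem
    rcases hγ hmem with h | h <;> simp [h]

/-- The contribution of an arbitrary scale, with the same constant `M` for all scales because the
lattice sums scale with the dilation. -/
theorem waveletScale_le {a : ℝ} (ha : 0 < a) {β : ℝ} (hβ : 0 < β) (φ : L2R) (j : ℤ)
    {M : ℝ≥0∞} (hM : M ≠ ∞) (f : L2R)
    (hs : ∀ᵐ γ : ℝ, ∑' n : ℤ, ‖(𝓕 φ : L2R) (n * (1 / β) + γ)‖ₑ ≤ M) :
    ENNReal.ofReal (a ^ j)⁻¹ *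
      scaleEnergy (a ^ j / β) (fun γ => (𝓕 φ : L2R) ((a ^ j)⁻¹ * γ)) (𝓕 f : L2R) ≤
    ENNReal.ofReal (1 / β) *
      (M * ∫⁻ γ, ‖(𝓕 φ : L2R) ((a ^ j)⁻¹ * γ)‖ₑ * ‖(𝓕 f : L2R) γ‖ₑ ^ 2) := by
  have haj := zpow_pos ha j
  have h := scaleEnergy_le (T := a ^ j / β) (by positivity) hM
    (memLp_comp_mul_left (inv_pos.2 haj).ne' (Lp.memLp (𝓕 φ : L2R))) (Lp.memLp (𝓕 f : L2R)) ?_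
  · grw [h, ← mul_assoc, ← ENNReal.ofReal_mul (inv_pos.2 haj).le]
    refine le_of_eq ?_
    congr 2
    field_simp
  · filter_upwards [(quasiMeasurePreserving_mul_left (inv_pos.2 haj).ne').ae hs] with γ hγ
    refine le_of_eq_of_le (tsum_congr fun n => ?_) hγ
    congr 2
    field_simp

/-- For a band-limited generator, oversampled so much that no scale aliases, the energy of the
wavelet system is a weighted norm on the Fourier side. -/
theorem frameEnergy_eq_of_bandlimited {a : ℝ} (ha : 0 < a) {β K : ℝ} (hβ : 0 < β)
    (hK : 2 * K < 1 / β) {φ : L2R} (hφ : MemLp (𝓕 φ : L2R) ∞ volume)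
    (hsupp : ∀ᵐ γ : ℝ, γ ∉ Set.Icc (-K) K → (𝓕 φ : L2R) γ = 0) (f : L2R) :
    frameEnergy (waveletSystem a ha β φ) f =
      ENNReal.ofReal (1 / β) * ∫⁻ γ, energyDensity a φ γ * ‖(𝓕 f : L2R) γ‖ₑ ^ 2 := by
  have hm := measurable_fourier φ
  have hmf := measurable_fourier f
  have h1 : ∫⁻ γ, energyDensity a φ γ * ‖(𝓕 f : L2R) γ‖ₑ ^ 2 =
      ∑' j : ℤ, ∫⁻ γ, ‖(𝓕 φ : L2R) ((a ^ j)⁻¹ * γ)‖ₑ ^ 2 * ‖(𝓕 f : L2R) γ‖ₑ ^ 2 := by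
    simp only [energyDensity, ← ENNReal.tsum_mul_right]
    exact lintegral_tsum fun j => Measurable.aemeasurable (by fun_prop)
  rw [frameEnergy_waveletSystem, h1, ← ENNReal.tsum_mul_left]
  refine tsum_congr fun j => ?_
  have haj := zpow_pos ha j
  refine waveletScale_eq_of_support ha hβ φ j hφ (-(a ^ j / β / 2)) f ?_
  filter_upwards [(quasiMeasurePreserving_mul_left (inv_pos.2 haj).ne').ae hsupp] with γ hγ hmem
  refine Or.inl (hγ fun h => hmem ?_)
  rw [Set.mem_Icc, ← div_eq_inv_mul, le_div_iff₀ haj, div_le_iff₀ haj] at h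
  have h2 : 2 * K * a ^ j < a ^ j / β := by
    rw [div_eq_mul_one_div, mul_comm (a ^ j)]
    gcongr
  constructor <;> linarith

/-- A Bessel bound from the sums of `|φ̂|` along the dual lattice and along the dilations. -/
theorem frameEnergy_le_of_tsum_le {a : ℝ} (ha : 0 < a) {β : ℝ} (hβ : 0 < β) {φ : L2R}
    {M S : ℝ≥0∞} (hM : M ≠ ∞)
    (h1 : ∀ᵐ γ : ℝ, ∑' n : ℤ, ‖(𝓕 φ : L2R) (n * (1 / β) + γ)‖ₑ ≤ M)
    (h2 : ∀ᵐ γ : ℝ, ∑' j : ℤ, ‖(𝓕 φ : L2R) ((a ^ j)⁻¹ * γ)‖ₑ ≤ S) (f : L2R) :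
    frameEnergy (waveletSystem a ha β φ) f ≤ ENNReal.ofReal (1 / β) * (M * S) * ‖f‖ₑ ^ 2 := by
  have hm := measurable_fourier φ
  have hmf := measurable_fourier f
  rw [frameEnergy_waveletSystem]
  refine (ENNReal.tsum_le_tsum fun j => waveletScale_le ha hβ φ j hM f h1).trans ?_
  rw [ENNReal.tsum_mul_left, ENNReal.tsum_mul_left, ← lintegral_tsum fun j =>
    Measurable.aemeasurable (by fun_prop), mul_assoc, mul_assoc]
  gcongr
  rw [enorm_sq_eq_lintegral_fourier, ← lintegral_const_mul _ (by fun_prop)]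
  refine lintegral_mono_ae ?_
  filter_upwards [h2] with γ hγ
  rw [ENNReal.tsum_mul_right]
  gcongr

/-! ### Sums of a power tail along arithmetic and geometric progressions -/

/-- The power `x ^ (-s)`, cut off to the half-line `x > R`. -/
def tailWeight (s R x : ℝ) : ℝ≥0∞ := if R < x then ENNReal.ofReal (x ^ (-s)) else 0

theorem tailWeight_of_le {s R x : ℝ} (h : x ≤ R) : tailWeight s R x = 0 := if_neg h.not_gt

theorem tailWeight_le {s R x y : ℝ} (hs : 0 ≤ s) (hy : 0 < y) (hyx : y ≤ x) :
    tailWeight s R x ≤ ENNReal.ofReal (y ^ (-s)) := by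
  unfold tailWeight
  split_ifs
  · exact ENNReal.ofReal_le_ofReal (Real.rpow_le_rpow_of_nonpos hy hyx (by linarith))
  · exact zero_le

theorem tsum_int_eq (f : ℤ → ℝ≥0∞) :
    ∑' n : ℤ, f n = ∑' n : ℕ, f n + ∑' n : ℕ, f (-(n + 1 : ℤ)) :=
  tsum_of_nat_of_neg_add_one ENNReal.summable ENNReal.summable

/-- Comparison of one term of the sum with the integral of `t ^ (-1 - σ)` over `[u, v]`. -/
theorem mul_rpow_le_sub_rpow {σ u v : ℝ} (hσ : 0 < σ) (hu : 0 < u) (hv : 0 < v) :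
    σ * (v - u) * v ^ (-(1 + σ)) ≤ u ^ (-σ) - v ^ (-σ) := by
  have h1 : 1 + σ * (1 - (v / u)⁻¹) ≤ (v / u) ^ σ := by
    rw [Real.rpow_def_of_pos (by positivity)]
    have h2 := Real.add_one_le_exp (Real.log (v / u) * σ)
    have h3 := Real.one_sub_inv_le_log_of_pos (show 0 < v / u by positivity)
    nlinarith
  have h4 : u ^ (-σ) = v ^ (-σ) * (v / u) ^ σ := by
    rw [Real.div_rpow hv.le hu.le, Real.rpow_neg hu.le, Real.rpow_neg hv.le]
    have := (Real.rpow_pos_of_pos hv σ).ne'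
    field_simp
  have h5 : v ^ (-(1 + σ)) = v ^ (-σ) * v⁻¹ := by
    rw [neg_add, add_comm, Real.rpow_add hv, Real.rpow_neg_one]
  have h6 : 0 < v ^ (-σ) := Real.rpow_pos_of_pos hv _
  have h7 : σ * (v - u) * (v ^ (-σ) * v⁻¹) = v ^ (-σ) * (σ * (1 - (v / u)⁻¹)) := by
    field_simp
  rw [h4, h5, h7]
  nlinarith

/-- A sum over an arithmetic progression: the first point beyond `R` contributes at most
`R ^ (-(1 + σ))`, the others telescope. -/
theorem tsum_tailWeight_arith_le {σ R δ : ℝ} (hσ : 0 < σ) (hR : 0 < R) (hδ : 0 < δ) (x : ℝ) :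
    ∑' n : ℤ, tailWeight (1 + σ) R (n * δ + x) ≤
      ENNReal.ofReal (R ^ (-(1 + σ)) * (1 + R / (δ * σ))) := by
  -- `n₀` is the first index whose point lies beyond `R`
  set n₀ : ℤ := ⌊(R - x) / δ⌋ + 1 with hn₀
  have h1 : R < n₀ * δ + x := by
    have := Int.lt_floor_add_one ((R - x) / δ)
    rw [div_lt_iff₀ hδ] at this
    rw [hn₀]; push_cast; linarith
  have h2 : (n₀ - 1) * δ + x ≤ R := by
    have := Int.floor_le ((R - x) / δ)
    rw [le_div_iff₀ hδ] at this
    rw [hn₀]; push_cast; linarith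
  rw [← (Equiv.addRight n₀).tsum_eq, tsum_int_eq]
  have hneg : ∑' n : ℕ, tailWeight (1 + σ) R
      (((Equiv.addRight n₀) (-(n + 1 : ℤ)) : ℤ) * δ + x) = 0 := by
    refine ENNReal.tsum_eq_zero.2 fun n => tailWeight_of_le (le_trans ?_ h2)
    have : (0 : ℝ) ≤ n * δ := by positivity
    simp only [Equiv.coe_addRight]
    push_cast
    linarith
  rw [hneg, add_zero]
  refine ENNReal.tsum_le_of_sum_range_le fun N => ?_
  -- telescoping bound for the partial sums
  have key : ∀ N : ℕ, ∑ m ∈ Finset.range N, (R + m * δ) ^ (-(1 + σ)) ≤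
      R ^ (-(1 + σ)) + (δ * σ)⁻¹ * R ^ (-σ) := fun N => by
    have hpos : ∀ m : ℕ, 0 < R + m * δ := fun m => by positivity
    have h3 : ∀ N : ℕ, ∑ m ∈ Finset.range (N + 1), (R + m * δ) ^ (-(1 + σ)) ≤
        R ^ (-(1 + σ)) + (δ * σ)⁻¹ * (R ^ (-σ) - (R + N * δ) ^ (-σ)) := fun N => by
      induction N with
      | zero => simp
      | succ N ih =>
        rw [Finset.sum_range_succ]
        have h4 := mul_rpow_le_sub_rpow hσ (hpos N) (hpos (N + 1))
        have h5 : R + ((N + 1 : ℕ) : ℝ) * δ - (R + N * δ) = δ := by push_cast; ring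
        rw [h5, mul_comm σ δ, ← le_inv_mul_iff₀ (by positivity)] at h4
        linarith [mul_sub (δ * σ)⁻¹ (R ^ (-σ)) ((R + N * δ) ^ (-σ)),
          mul_sub (δ * σ)⁻¹ (R ^ (-σ)) ((R + (N + 1 : ℕ) * δ) ^ (-σ)),
          mul_sub (δ * σ)⁻¹ ((R + N * δ) ^ (-σ)) ((R + (N + 1 : ℕ) * δ) ^ (-σ))]
    have h6 := h3 N
    rw [Finset.sum_range_succ] at h6
    have h7 : 0 ≤ (R + N * δ) ^ (-(1 + σ)) := (Real.rpow_pos_of_pos (hpos N) _).le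
    have h8 : 0 ≤ (δ * σ)⁻¹ * (R + N * δ) ^ (-σ) :=
      mul_nonneg (by positivity) (Real.rpow_pos_of_pos (hpos N) _).le
    linarith [mul_sub (δ * σ)⁻¹ (R ^ (-σ)) ((R + N * δ) ^ (-σ))]
  have hRσ : R ^ (-σ) = R ^ (-(1 + σ)) * R := by
    rw [show -σ = -(1 + σ) + 1 by ring, Real.rpow_add hR, Real.rpow_one]
  calc ∑ m ∈ Finset.range N, tailWeight (1 + σ) R (((Equiv.addRight n₀) (m : ℤ) : ℤ) * δ + x)
      ≤ ∑ m ∈ Finset.range N, ENNReal.ofReal ((R + m * δ) ^ (-(1 + σ))) := by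
        refine Finset.sum_le_sum fun m _ => tailWeight_le (by linarith) (by positivity) ?_
        simp only [Equiv.coe_addRight]
        push_cast
        linarith
    _ = ENNReal.ofReal (∑ m ∈ Finset.range N, (R + m * δ) ^ (-(1 + σ))) :=
        (ENNReal.ofReal_sum_of_nonneg fun m _ => by positivity).symm
    _ ≤ _ := by
        refine ENNReal.ofReal_le_ofReal ((key N).trans_eq ?_)
        rw [hRσ]
        field_simp

theorem tsum_tailWeight_geom_le {a s R : ℝ} (ha : 1 < a) (hs : 0 < s) (hR : 0 < R) (x : ℝ) :
    ∑' j : ℤ, tailWeight s R ((a ^ j)⁻¹ * x) ≤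
      ENNReal.ofReal (R ^ (-s) * (a ^ s / (a ^ s - 1))) := by
  have ha0 : 0 < a := by linarith
  rcases le_or_gt x 0 with hx | hx
  · have : ∑' j : ℤ, tailWeight s R ((a ^ j)⁻¹ * x) = 0 :=
      ENNReal.tsum_eq_zero.2 fun j => tailWeight_of_le
        ((mul_nonpos_of_nonneg_of_nonpos (inv_nonneg.2 (zpow_pos ha0 j).le) hx).trans hR.le)
    rw [this]
    exact zero_le
  -- `a ^ (n + 1) * x` is the first point of the progression beyond `R`
  obtain ⟨n, hn1, hn2⟩ := exists_mem_Ico_zpow (show 0 < R / x by positivity) ha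
  rw [le_div_iff₀ hx] at hn1
  rw [div_lt_iff₀ hx] at hn2
  rw [← (Equiv.neg ℤ).tsum_eq, ← (Equiv.addRight (n + 1)).tsum_eq, tsum_int_eq]
  have hneg : ∑' m : ℕ, tailWeight s R ((a ^ ((Equiv.neg ℤ)
      ((Equiv.addRight (n + 1)) (-(m + 1 : ℤ)))))⁻¹ * x) = 0 := by
    refine ENNReal.tsum_eq_zero.2 fun m => tailWeight_of_le (le_trans ?_ hn1)
    simp only [Equiv.coe_addRight, Equiv.neg_apply, zpow_neg, inv_inv]
    gcongr
    · exact ha.le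
    · omega
  rw [hneg, add_zero]
  have has : 1 < a ^ s := Real.one_lt_rpow ha hs
  have h3 : ∀ m : ℕ, tailWeight s R ((a ^ ((Equiv.neg ℤ)
      ((Equiv.addRight (n + 1)) (m : ℤ))))⁻¹ * x) ≤
      ENNReal.ofReal (R ^ (-s) * ((a ^ s)⁻¹) ^ m) := fun m => by
    have h4 : R ^ (-s) * ((a ^ s)⁻¹) ^ m = (a ^ m * R) ^ (-s) := by
      rw [Real.mul_rpow (by positivity) hR.le, mul_comm, ← Real.rpow_natCast a m,
        ← Real.rpow_mul ha0.le, ← Real.rpow_neg ha0.le, ← Real.rpow_natCast (a ^ (-s)),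
        ← Real.rpow_mul ha0.le]
      congr 2; ring
    rw [h4]
    refine tailWeight_le hs.le (by positivity) ?_
    simp only [Equiv.coe_addRight, Equiv.neg_apply, zpow_neg, inv_inv]
    rw [zpow_add₀ ha0.ne', zpow_natCast, mul_assoc]
    gcongr
  refine (ENNReal.tsum_le_tsum h3).trans_eq ?_
  have h5 : (a ^ s)⁻¹ < 1 := inv_lt_one_of_one_lt₀ has
  have h6 := (hasSum_geometric_of_lt_one (by positivity) h5).mul_left (R ^ (-s))
  rw [← ENNReal.ofReal_tsum_of_nonneg (fun m => by positivity) h6.summable, h6.tsum_eq]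
  congr 2
  have : a ^ s - 1 ≠ 0 := by linarith
  field_simp

/-! ### Truncation of the generator and the size of its tail -/

theorem fourier_truncation (K : ℝ) (ψ : L2R) :
    (𝓕 (truncation K ψ) : L2R) =ᵐ[volume] (Set.Icc (-K) K).indicator (𝓕 ψ : L2R) := by
  rw [truncation, FourierTransform.fourier_fourierInv_eq]
  exact MemLp.coeFn_toLp _

theorem fourier_sub_truncation (K : ℝ) (ψ : L2R) :
    (𝓕 (ψ - truncation K ψ) : L2R) =ᵐ[volume] (Set.Icc (-K) K)ᶜ.indicator (𝓕 ψ : L2R) := by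
  have h : (𝓕 (ψ - truncation K ψ) : L2R) = (𝓕 ψ : L2R) - (𝓕 (truncation K ψ) : L2R) :=
    map_sub (Lp.fourierTransformₗᵢ ℝ ℂ) _ _
  rw [h]
  filter_upwards [Lp.coeFn_sub (𝓕 ψ : L2R) (𝓕 (truncation K ψ) : L2R),
    fourier_truncation K ψ] with γ h1 h2
  rw [h1, Pi.sub_apply, h2, Set.indicator_compl, Pi.sub_apply]

/-- The Fourier transform of `ψ` decays like `|γ| ^ (-(1 + σ))`, with constant `C`. -/
def FourierDecay (C σ : ℝ) (ψ : L2R) : Prop :=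
  ∀ᵐ γ : ℝ, ‖(𝓕 ψ : L2R) γ‖ ≤ C / (1 + |γ| ^ (1 + σ))

section Decay

variable {C σ : ℝ} {ψ : L2R}

theorem FourierDecay.memLp_top (h : FourierDecay C σ ψ) (hC : 0 < C) :
    MemLp (𝓕 ψ : L2R) ∞ volume := by
  refine memLp_top_of_bound (Lp.aestronglyMeasurable _) C ?_
  filter_upwards [h] with γ hγ
  refine hγ.trans (div_le_self hC.le ?_)
  have : 0 ≤ |γ| ^ (1 + σ) := by positivity
  linarith

theorem memLp_top_truncation (K : ℝ) (h : MemLp (𝓕 ψ : L2R) ∞ volume) :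
    MemLp (𝓕 (truncation K ψ) : L2R) ∞ volume :=
  (memLp_congr_ae (fourier_truncation K ψ)).2 (h.indicator measurableSet_Icc)

theorem FourierDecay.enorm_tail_le (h : FourierDecay C σ ψ) (hC : 0 < C) {R : ℝ} (hR : 0 < R) :
    ∀ᵐ γ : ℝ, ‖(𝓕 (ψ - truncation R ψ) : L2R) γ‖ₑ ≤
      ENNReal.ofReal C * (tailWeight (1 + σ) R γ + tailWeight (1 + σ) R (-γ)) := by
  filter_upwards [h, fourier_sub_truncation R ψ] with γ h1 h2
  rw [h2]
  by_cases hγ : γ ∈ Set.Icc (-R) R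
  · rw [Set.indicator_of_notMem (by simpa using hγ)]
    simp
  · rw [Set.indicator_of_mem (by simpa using hγ)]
    have hlt : R < |γ| := by
      by_contra! hcon
      exact hγ (abs_le.1 hcon)
    have hpos : 0 < |γ| := hR.trans hlt
    have h3 : ‖(𝓕 ψ : L2R) γ‖ₑ ≤ ENNReal.ofReal C * tailWeight (1 + σ) R |γ| := by
      rw [tailWeight, if_pos hlt, ← ENNReal.ofReal_mul hC.le, ← ofReal_norm]
      refine ENNReal.ofReal_le_ofReal (h1.trans ?_)
      rw [Real.rpow_neg hpos.le, ← div_eq_mul_inv]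
      gcongr
      linarith
    refine h3.trans ?_
    gcongr
    rcases abs_choice γ with h4 | h4 <;> rw [h4]
    · exact le_self_add
    · exact le_add_self

/-- The bound for the tail along the dual lattice, one summand for each half-line. -/
theorem FourierDecay.tsum_tail_lattice_le (h : FourierDecay C σ ψ) (hC : 0 < C) (hσ : 0 < σ)
    {R β : ℝ} (hR : 0 < R) (hβ : 0 < β) :
    ∀ᵐ γ : ℝ, ∑' n : ℤ, ‖(𝓕 (ψ - truncation R ψ) : L2R) (n * (1 / β) + γ)‖ₑ ≤
      ENNReal.ofReal (2 * C * (R ^ (-(1 + σ)) * (1 + R * β / σ))) := by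
  have h1 : ∀ᵐ γ : ℝ, ∀ n : ℤ, ‖(𝓕 (ψ - truncation R ψ) : L2R) (n * (1 / β) + γ)‖ₑ ≤
      ENNReal.ofReal C * (tailWeight (1 + σ) R (n * (1 / β) + γ) +
        tailWeight (1 + σ) R (-(n * (1 / β) + γ))) :=
    ae_all_iff.2 fun n =>
      (measurePreserving_add_left volume (n * (1 / β))).quasiMeasurePreserving.ae
        (h.enorm_tail_le hC hR)
  filter_upwards [h1] with γ hγ
  have hb : (0 : ℝ) < 1 / β := by positivity
  refine (ENNReal.tsum_le_tsum hγ).trans ?_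
  rw [ENNReal.tsum_mul_left, ENNReal.tsum_add]
  have h2 := tsum_tailWeight_arith_le hσ hR hb γ
  have h3 : ∑' n : ℤ, tailWeight (1 + σ) R (-(n * (1 / β) + γ)) ≤
      ENNReal.ofReal (R ^ (-(1 + σ)) * (1 + R / (1 / β * σ))) := by
    rw [← (Equiv.neg ℤ).tsum_eq]
    refine le_of_eq_of_le (tsum_congr fun n => ?_) (tsum_tailWeight_arith_le hσ hR hb (-γ))
    congr 1
    simp only [Equiv.neg_apply]
    push_cast
    ring
  grw [h2, h3]
  have h4 : 0 ≤ R ^ (-(1 + σ)) * (1 + R / (1 / β * σ)) := by positivity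
  rw [← ENNReal.ofReal_add h4 h4, ← ENNReal.ofReal_mul hC.le]
  refine le_of_eq (congrArg _ ?_)
  field_simp
  ring

theorem FourierDecay.tsum_tail_dilation_le (h : FourierDecay C σ ψ) (hC : 0 < C) (hσ : 0 < σ)
    {a R : ℝ} (ha : 1 < a) (hR : 0 < R) :
    ∀ᵐ γ : ℝ, ∑' j : ℤ, ‖(𝓕 (ψ - truncation R ψ) : L2R) ((a ^ j)⁻¹ * γ)‖ₑ ≤
      ENNReal.ofReal (C * (R ^ (-(1 + σ)) * (a ^ (1 + σ) / (a ^ (1 + σ) - 1)))) := by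
  have ha0 : 0 < a := by linarith
  have h1 : ∀ᵐ γ : ℝ, ∀ j : ℤ, ‖(𝓕 (ψ - truncation R ψ) : L2R) ((a ^ j)⁻¹ * γ)‖ₑ ≤
      ENNReal.ofReal C * (tailWeight (1 + σ) R ((a ^ j)⁻¹ * γ) +
        tailWeight (1 + σ) R (-((a ^ j)⁻¹ * γ))) :=
    ae_all_iff.2 fun j => (quasiMeasurePreserving_mul_left
      (inv_pos.2 (zpow_pos ha0 j)).ne').ae (h.enorm_tail_le hC hR)
  filter_upwards [h1] with γ hγ
  -- only one of the two half-lines meets the orbit of `γ`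
  have h2 : ∀ x : ℝ, x ≤ 0 → ∀ j : ℤ, tailWeight (1 + σ) R ((a ^ j)⁻¹ * x) = 0 := fun x hx j =>
    tailWeight_of_le ((mul_nonpos_of_nonneg_of_nonpos
      (inv_nonneg.2 (zpow_pos ha0 j).le) hx).trans hR.le)
  have h3 : ∀ j : ℤ, ‖(𝓕 (ψ - truncation R ψ) : L2R) ((a ^ j)⁻¹ * γ)‖ₑ ≤
      ENNReal.ofReal C * tailWeight (1 + σ) R ((a ^ j)⁻¹ * |γ|) := fun j => by
    refine (hγ j).trans ?_
    rcases le_total γ 0 with h0 | h0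
    · rw [h2 γ h0, zero_add, abs_of_nonpos h0, mul_neg]
    · rw [← mul_neg, h2 (-γ) (by linarith), add_zero, abs_of_nonneg h0]
  refine (ENNReal.tsum_le_tsum h3).trans ?_
  rw [ENNReal.tsum_mul_left, ENNReal.ofReal_mul hC.le]
  gcongr
  exact tsum_tailWeight_geom_le ha (by linarith) hR _

theorem FourierDecay.energyDensity_tail_le (h : FourierDecay C σ ψ) (hC : 0 < C) (hσ : 0 < σ)
    {a R : ℝ} (ha : 1 < a) (hR : 0 < R) :
    ∀ᵐ γ : ℝ, energyDensity a (ψ - truncation R ψ) γ ≤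
      ENNReal.ofReal (C ^ 2 * (R ^ (-(1 + σ))) ^ 2 * (a ^ (1 + σ) / (a ^ (1 + σ) - 1))) := by
  have ha0 : 0 < a := by linarith
  have h1 : ∀ᵐ γ : ℝ, ‖(𝓕 (ψ - truncation R ψ) : L2R) γ‖ₑ ≤
      ENNReal.ofReal (C * R ^ (-(1 + σ))) := by
    filter_upwards [h.enorm_tail_le hC hR] with γ hγ
    refine hγ.trans ?_
    rw [ENNReal.ofReal_mul hC.le]
    gcongr
    rcases le_or_gt γ R with h0 | h0
    · rw [tailWeight_of_le h0, zero_add]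
      rcases le_or_gt (-γ) R with h2 | h2
      · rw [tailWeight_of_le h2]; exact zero_le
      · exact tailWeight_le (by linarith) hR h2.le
    · rw [tailWeight_of_le (show -γ ≤ R by linarith), add_zero]
      exact tailWeight_le (by linarith) hR h0.le
  have h2 : ∀ᵐ γ : ℝ, ∀ j : ℤ, ‖(𝓕 (ψ - truncation R ψ) : L2R) ((a ^ j)⁻¹ * γ)‖ₑ ≤
      ENNReal.ofReal (C * R ^ (-(1 + σ))) := ae_all_iff.2 fun j =>
    (quasiMeasurePreserving_mul_left (inv_pos.2 (zpow_pos ha0 j)).ne').ae h1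
  filter_upwards [h2, h.tsum_tail_dilation_le hC hσ ha hR] with γ h3 h4
  calc energyDensity a (ψ - truncation R ψ) γ
      ≤ ∑' j : ℤ, ENNReal.ofReal (C * R ^ (-(1 + σ))) *
          ‖(𝓕 (ψ - truncation R ψ) : L2R) ((a ^ j)⁻¹ * γ)‖ₑ :=
        ENNReal.tsum_le_tsum fun j => by
          rw [sq]
          gcongr
          exact h3 j
    _ ≤ _ := by
        rw [ENNReal.tsum_mul_left]
        grw [h4]
        rw [← ENNReal.ofReal_mul (by positivity)]
        refine le_of_eq (congrArg _ ?_)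
        ring

end Decay

/-! ### Frame bounds control the energy density -/

/-- The point `0`, near which aliasing cannot be controlled, is negligible. -/
theorem ae_of_locally_ae {p : ℝ → Prop}
    (h : ∀ x : ℝ, x ≠ 0 → ∃ u ∈ 𝓝 x, ∀ᵐ γ ∂(volume.restrict u), p γ) : ∀ᵐ γ : ℝ, p γ := by
  have h1 : volume {γ : ℝ | γ ≠ 0 ∧ ¬ p γ} = 0 := by
    refine measure_null_of_locally_null _ fun x hx => ?_
    obtain ⟨u, hu, hp⟩ := h x hx.1
    obtain ⟨v, hvu, hv, hxv⟩ := mem_nhds_iff.1 hu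
    refine ⟨{γ : ℝ | γ ≠ 0 ∧ ¬ p γ} ∩ v, inter_mem_nhdsWithin _ (hv.mem_nhds hxv), ?_⟩
    have h2 := ae_restrict_of_ae_restrict_of_subset hvu hp
    rw [ae_restrict_iff' hv.measurableSet] at h2
    refine measure_mono_null ?_ h2
    rintro γ ⟨h3, h4⟩ h5
    exact h3.2 (h5 h4)
  have h2 : ∀ᵐ γ : ℝ, ¬ (γ ≠ 0 ∧ ¬ p γ) := measure_eq_zero_iff_ae_notMem.1 h1
  filter_upwards [h2, Measure.ae_ne volume (0 : ℝ)] with γ h3 h4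
  by_contra h5
  exact h3 ⟨h4, h5⟩

/-- Functions whose Fourier transform is the indicator function of a set `S` serve as test
functions for the frame inequalities. -/
theorem exists_fourier_eq_indicator {S : Set ℝ} (hS : MeasurableSet S) (hfin : volume S ≠ ∞) :
    ∃ f : L2R, (𝓕 f : L2R) =ᵐ[volume] S.indicator (fun _ => (1 : ℂ)) ∧ ‖f‖ₑ ^ 2 = volume S := by
  refine ⟨𝓕⁻ (indicatorConstLp 2 hS hfin (1 : ℂ)), ?_, ?_⟩
  · rw [FourierTransform.fourier_fourierInv_eq]
    exact indicatorConstLp_coeFn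
  · rw [← ofReal_norm, ← Lp.norm_fourier_eq, FourierTransform.fourier_fourierInv_eq, ofReal_norm,
      enorm_sq_eq_lintegral]
    have h : ∀ᵐ x, ‖(indicatorConstLp 2 hS hfin (1 : ℂ)) x‖ₑ ^ 2 = S.indicator 1 x := by
      filter_upwards [indicatorConstLp_coeFn (p := 2) (hs := hS) (hμs := hfin) (c := (1 : ℂ))]
        with x hx
      rw [hx]
      by_cases hxS : x ∈ S <;> simp [hxS]
    rw [lintegral_congr_ae h, lintegral_indicator_one hS]

theorem lintegral_mul_indicator {S : Set ℝ} (hS : MeasurableSet S) {g : ℝ → ℂ}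
    (hg : g =ᵐ[volume] S.indicator (fun _ => (1 : ℂ))) (w : ℝ → ℝ≥0∞) :
    ∫⁻ γ, w γ * ‖g γ‖ₑ ^ 2 = ∫⁻ γ in S, w γ := by
  rw [← lintegral_indicator hS]
  refine lintegral_congr_ae ?_
  filter_upwards [hg] with γ hγ
  rw [hγ]
  by_cases h : γ ∈ S <;> simp [h]

theorem scaleEnergy_congr {T : ℝ} {H H' f : ℝ → ℂ}
    (h : ∀ᵐ γ, starRingEnd ℂ (H γ) * f γ = starRingEnd ℂ (H' γ) * f γ) :
    scaleEnergy T H f = scaleEnergy T H' f := by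
  refine tsum_congr fun k => ?_
  congr 2
  refine integral_congr_ae ?_
  filter_upwards [h] with γ hγ
  rw [hγ]

theorem mem_nhds_Ioc_centered (x : ℝ) {h : ℝ} (hh : 0 < h) :
    Set.Ioc (x - h / 2) (x - h / 2 + h) ∈ 𝓝 x :=
  Ioc_mem_nhds (by linarith) (by linarith)

/-- An upper frame bound `B` forces `∑_j |ψ̂ (a ^ j γ)|² ≤ b B`: any finitely many scales do not
alias on a sufficiently short interval. -/
theorem energyDensity_le_of_frame {a b : ℝ} (ha : 0 < a) (hb : 0 < b) {ψ : L2R} {A B : ℝ}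
    (hframe : IsFrameWithBounds (waveletSystem a ha b ψ) A B)
    (hψ : MemLp (𝓕 ψ : L2R) ∞ volume) :
    ∀ᵐ γ : ℝ, energyDensity a ψ γ ≤ ENNReal.ofReal (b * B) := by
  have hm := measurable_fourier ψ
  suffices h : ∀ t : Finset ℤ, ∀ᵐ γ : ℝ,
      ∑ j ∈ t, ‖(𝓕 ψ : L2R) ((a ^ j)⁻¹ * γ)‖ₑ ^ 2 ≤ ENNReal.ofReal (b * B) by
    filter_upwards [ae_all_iff.2 h] with γ hγ
    rw [energyDensity, ENNReal.tsum_eq_iSup_sum]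
    exact iSup_le hγ
  intro t
  refine ae_of_locally_ae fun x _ => ?_
  -- on an interval of length `h`, none of the finitely many scales in `t` aliases
  obtain ⟨h, hh, hht⟩ : ∃ h : ℝ, 0 < h ∧ ∀ j ∈ t, h ≤ a ^ j / b := by
    have h1 : ∀ᶠ h : ℝ in 𝓝[>] 0, ∀ j ∈ t, h ≤ a ^ j / b := by
      rw [Filter.eventually_all_finset]
      intro j _
      have hpos : 0 < a ^ j / b := div_pos (zpow_pos ha j) hb
      filter_upwards [Ioc_mem_nhdsGT hpos] with h hh using hh.2
    obtain ⟨h, h2, h3⟩ := (h1.and self_mem_nhdsWithin).exists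
    exact ⟨h, h3, h2⟩
  refine ⟨_, mem_nhds_Ioc_centered x hh, ?_⟩
  set I := Set.Ioc (x - h / 2) (x - h / 2 + h)
  refine ae_le_of_forall_setLIntegral_le_of_sigmaFinite (Finset.measurable_sum _ fun j _ => by
    fun_prop) fun S' hS' _ => ?_
  rw [Measure.restrict_restrict hS']
  set S := S' ∩ I
  have hS : MeasurableSet S := hS'.inter measurableSet_Ioc
  have hfin : volume S ≠ ∞ := ((measure_mono Set.inter_subset_right).trans_lt measure_Ioc_lt_top).ne
  obtain ⟨f, hf, hfn⟩ := exists_fourier_eq_indicator hS hfin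
  have h1 := (hframe.frameEnergy_bounds f).2
  rw [frameEnergy_waveletSystem, hfn] at h1
  have h2 := (ENNReal.sum_le_tsum t).trans h1
  have h3 : ∀ j ∈ t, ENNReal.ofReal (a ^ j)⁻¹ *
      scaleEnergy (a ^ j / b) (fun γ => (𝓕 ψ : L2R) ((a ^ j)⁻¹ * γ)) (𝓕 f : L2R) =
      ENNReal.ofReal (1 / b) * ∫⁻ γ in S, ‖(𝓕 ψ : L2R) ((a ^ j)⁻¹ * γ)‖ₑ ^ 2 := fun j hj => by
    rw [waveletScale_eq_of_support ha hb ψ j hψ (x - h / 2) f, lintegral_mul_indicator hS hf]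
    filter_upwards [hf] with γ hγ hmem
    right
    rw [hγ, Set.indicator_of_notMem]
    intro hγS
    exact hmem ⟨hγS.2.1, hγS.2.2.trans (by linarith [hht j hj])⟩
  rw [Finset.sum_congr rfl h3, ← Finset.mul_sum, ← lintegral_finsetSum _ fun j _ => by
    fun_prop] at h2
  have h4 : ENNReal.ofReal b * ENNReal.ofReal (1 / b) = 1 := by
    rw [← ENNReal.ofReal_mul hb.le, mul_one_div_cancel hb.ne', ENNReal.ofReal_one]
  rw [setLIntegral_const, ENNReal.ofReal_mul hb.le, mul_assoc]
  calc _ = ENNReal.ofReal b * (ENNReal.ofReal (1 / b) * ∫⁻ γ in S,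
        ∑ j ∈ t, ‖(𝓕 ψ : L2R) ((a ^ j)⁻¹ * γ)‖ₑ ^ 2) := by rw [← mul_assoc, h4, one_mul]
    _ ≤ _ := by gcongr

/-- The lower bound for the energy density, up to the contribution `M S` of the scales that alias
on a short interval; those scales only see the tail of `ψ` beyond `R`. -/
theorem le_energyDensity_add_of_frame {a b : ℝ} (ha : 0 < a) (hb : 0 < b) {ψ : L2R} {A B : ℝ}
    (hframe : IsFrameWithBounds (waveletSystem a ha b ψ) A B)
    (hψ : MemLp (𝓕 ψ : L2R) ∞ volume) {R : ℝ} (hR : 0 < R) {M S : ℝ≥0∞} (hM : M ≠ ∞)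
    (h1 : ∀ᵐ γ : ℝ, ∑' n : ℤ, ‖(𝓕 (ψ - truncation R ψ) : L2R) (n * (1 / b) + γ)‖ₑ ≤ M)
    (h2 : ∀ᵐ γ : ℝ, ∑' j : ℤ, ‖(𝓕 (ψ - truncation R ψ) : L2R) ((a ^ j)⁻¹ * γ)‖ₑ ≤ S) :
    ∀ᵐ γ : ℝ, ENNReal.ofReal (b * A) ≤ energyDensity a ψ γ + M * S := by
  have hm := measurable_fourier ψ
  have hmt := measurable_fourier (ψ - truncation R ψ)
  have hmE := measurable_energyDensity a ψ
  have h4 : ENNReal.ofReal b * ENNReal.ofReal (1 / b) = 1 := by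
    rw [← ENNReal.ofReal_mul hb.le, mul_one_div_cancel hb.ne', ENNReal.ofReal_one]
  refine ae_of_locally_ae fun x hx => ?_
  have hx' : 0 < |x| := abs_pos.2 hx
  -- the interval is so short that each scale either does not alias or only sees the tail of `ψ`
  set h : ℝ := min |x| (|x| / 2 / (b * R)) with hh_def
  have hh : 0 < h := lt_min hx' (by positivity)
  refine ⟨_, mem_nhds_Ioc_centered x hh, ?_⟩
  set I := Set.Ioc (x - h / 2) (x - h / 2 + h)
  have hI : ∀ γ ∈ I, |x| / 2 ≤ |γ| := fun γ hγ => by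
    have h5 : |x - γ| ≤ h / 2 := abs_le.2 ⟨by linarith [hγ.2], by linarith [hγ.1]⟩
    have h6 := abs_sub_abs_le_abs_sub x γ
    have h7 : h ≤ |x| := min_le_left _ _
    linarith
  refine ae_le_of_forall_setLIntegral_le_of_sigmaFinite measurable_const fun S' hS' _ => ?_
  rw [Measure.restrict_restrict hS']
  set E := S' ∩ I
  have hE : MeasurableSet E := hS'.inter measurableSet_Ioc
  have hfin : volume E ≠ ∞ := ((measure_mono Set.inter_subset_right).trans_lt measure_Ioc_lt_top).ne
  obtain ⟨f, hf, hfn⟩ := exists_fourier_eq_indicator hE hfin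
  have h5 := (hframe.frameEnergy_bounds f).1
  rw [frameEnergy_waveletSystem, hfn] at h5
  have h6 : ∀ j : ℤ, ENNReal.ofReal (a ^ j)⁻¹ *
      scaleEnergy (a ^ j / b) (fun γ => (𝓕 ψ : L2R) ((a ^ j)⁻¹ * γ)) (𝓕 f : L2R) ≤
      ENNReal.ofReal (1 / b) * (∫⁻ γ in E, ‖(𝓕 ψ : L2R) ((a ^ j)⁻¹ * γ)‖ₑ ^ 2) +
      ENNReal.ofReal (1 / b) *
        (M * ∫⁻ γ in E, ‖(𝓕 (ψ - truncation R ψ) : L2R) ((a ^ j)⁻¹ * γ)‖ₑ) := fun j => by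
    have haj := zpow_pos ha j
    rcases le_or_gt h (a ^ j / b) with hj | hj
    · refine le_of_eq_of_le ?_ le_self_add
      rw [waveletScale_eq_of_support ha hb ψ j hψ (x - h / 2) f, lintegral_mul_indicator hE hf]
      filter_upwards [hf] with γ hγ hmem
      right
      rw [hγ, Set.indicator_of_notMem]
      intro hγS
      exact hmem ⟨hγS.2.1, hγS.2.2.trans (by linarith)⟩
    · refine le_trans ?_ le_add_self
      rw [← lintegral_mul_indicator hE hf]
      refine le_of_eq_of_le ?_
        (waveletScale_le ha hb (ψ - truncation R ψ) j hM f h1)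
      congr 1
      refine scaleEnergy_congr ?_
      filter_upwards [hf, (quasiMeasurePreserving_mul_left (inv_pos.2 haj).ne').ae
        (fourier_sub_truncation R ψ)] with γ h7 h8
      rw [h7]
      by_cases hγ : γ ∈ E
      · suffices h9 : (a ^ j)⁻¹ * γ ∈ (Set.Icc (-R) R)ᶜ by rw [h8, Set.indicator_of_mem h9]
        intro h9
        have h10 : |(a ^ j)⁻¹ * γ| ≤ R := abs_le.2 h9
        rw [abs_mul, abs_of_pos (inv_pos.2 haj), ← div_eq_inv_mul, div_le_iff₀ haj] at h10
        have h11 := hI γ hγ.2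
        have h12 : a ^ j < |x| / 2 / (b * R) * b := by
          rw [div_lt_iff₀ hb] at hj
          refine hj.trans_le ?_
          gcongr
          exact min_le_right _ _
        have h13 : |x| / 2 / (b * R) * b = |x| / 2 / R := by field_simp
        rw [h13, lt_div_iff₀ hR] at h12
        linarith
      · simp [hγ]
  have h7 := h5.trans (ENNReal.tsum_le_tsum h6)
  rw [ENNReal.tsum_add, ENNReal.tsum_mul_left, ENNReal.tsum_mul_left, ENNReal.tsum_mul_left,
    ← lintegral_tsum fun j => by fun_prop, ← lintegral_tsum fun j => by fun_prop, ← mul_add] at h7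
  have h8 : ∫⁻ γ in E, ∑' j : ℤ, ‖(𝓕 (ψ - truncation R ψ) : L2R) ((a ^ j)⁻¹ * γ)‖ₑ ≤
      ∫⁻ _ in E, S := lintegral_mono_ae (ae_restrict_of_ae h2)
  rw [setLIntegral_const, lintegral_add_left hmE, setLIntegral_const, ENNReal.ofReal_mul hb.le,
    mul_assoc]
  calc _ ≤ ENNReal.ofReal b * (ENNReal.ofReal (1 / b) *
        ((∫⁻ γ in E, energyDensity a ψ γ) + M * ∫⁻ γ in E,
          ∑' j : ℤ, ‖(𝓕 (ψ - truncation R ψ) : L2R) ((a ^ j)⁻¹ * γ)‖ₑ)) := by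
        exact mul_le_mul' le_rfl h7
    _ ≤ _ := by
        rw [← mul_assoc, h4, one_mul, mul_assoc]
        exact add_le_add le_rfl (mul_le_mul' le_rfl (h8.trans_eq (setLIntegral_const _ _)))

/-- A lower frame bound `A` forces `∑_j |ψ̂ (a ^ j γ)|² ≥ b A`. -/
theorem le_energyDensity_of_frame {a b : ℝ} (ha : 1 < a) (hb : 0 < b) {ψ : L2R} {A B : ℝ}
    (hframe : IsFrameWithBounds (waveletSystem a (zero_lt_one.trans ha) b ψ) A B)
    {C σ : ℝ} (hC : 0 < C) (hσ : 0 < σ) (hdecay : FourierDecay C σ ψ) :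
    ∀ᵐ γ : ℝ, ENNReal.ofReal (b * A) ≤ energyDensity a ψ γ := by
  have h1 : ∀ n : ℕ, ∀ᵐ γ : ℝ, ENNReal.ofReal (b * A) ≤ energyDensity a ψ γ +
      ENNReal.ofReal (2 * C * (((n : ℝ) + 1) ^ (-(1 + σ)) * (1 + ((n : ℝ) + 1) * b / σ))) *
      ENNReal.ofReal (C * (((n : ℝ) + 1) ^ (-(1 + σ)) * (a ^ (1 + σ) / (a ^ (1 + σ) - 1)))) :=
    fun n => le_energyDensity_add_of_frame (zero_lt_one.trans ha) hb hframe (hdecay.memLp_top hC)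
      (by positivity) ENNReal.ofReal_ne_top (hdecay.tsum_tail_lattice_le hC hσ (by positivity) hb)
      (hdecay.tsum_tail_dilation_le hC hσ ha (by positivity))
  have hcast : Tendsto (fun n : ℕ => (n : ℝ) + 1) atTop atTop :=
    tendsto_atTop_add_const_right _ _ tendsto_natCast_atTop_atTop
  have h2 : Tendsto (fun R : ℝ => R ^ (-(1 + σ))) atTop (𝓝 0) :=
    tendsto_rpow_neg_atTop (by linarith)
  have h3 : Tendsto (fun R : ℝ => R ^ (-(1 + σ)) * (1 + R * b / σ)) atTop (𝓝 0) := by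
    have h4 := h2.add ((tendsto_rpow_neg_atTop hσ).mul_const (b / σ))
    rw [zero_mul, add_zero] at h4
    refine h4.congr' ?_
    filter_upwards [eventually_gt_atTop 0] with R hR
    have : R ^ (-σ) = R ^ (-(1 + σ)) * R := by
      rw [show -σ = -(1 + σ) + 1 by ring, Real.rpow_add hR, Real.rpow_one]
    rw [this]
    ring
  have h5 := ENNReal.tendsto_ofReal ((h3.const_mul (2 * C)).comp hcast)
  have h6 := ENNReal.tendsto_ofReal
    (((h2.mul_const (a ^ (1 + σ) / (a ^ (1 + σ) - 1))).const_mul C).comp hcast)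
  have h7 := ENNReal.Tendsto.mul h5 (by simp) h6 (by simp)
  filter_upwards [ae_all_iff.2 h1] with γ hγ
  have h8 := h7.const_add (energyDensity a ψ γ)
  simp only [mul_zero, zero_mul, ENNReal.ofReal_zero, add_zero] at h8
  exact ge_of_tendsto' h8 hγ

/-! ### Fourier multipliers -/

/-- The operator on `L²(ℝ)` that multiplies Fourier transforms by the bounded function `m`. -/
def fourierMultiplier (m : ℝ → ℂ) (hm : MemLp m ∞ volume) : L2R →L[ℂ] L2R :=
  (Lp.fourierTransformₗᵢ ℝ ℂ).symm.toContinuousLinearEquiv.toContinuousLinearMap ∘L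
    mulOperator m hm ∘L (Lp.fourierTransformₗᵢ ℝ ℂ).toContinuousLinearEquiv.toContinuousLinearMap

theorem fourier_fourierMultiplier (m : ℝ → ℂ) (hm : MemLp m ∞ volume) (f : L2R) :
    (𝓕 (fourierMultiplier m hm f) : L2R) =ᵐ[volume] fun γ => m γ * (𝓕 f : L2R) γ := by
  have h : (𝓕 (fourierMultiplier m hm f) : L2R) = mulOperator m hm (𝓕 f : L2R) :=
    (Lp.fourierTransformₗᵢ ℝ ℂ).apply_symm_apply _
  rw [h]
  exact coeFn_mulOperator _ _ _

theorem inner_eq_integral_fourier (f g : L2R) :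
    inner ℂ f g = ∫ γ, (𝓕 g : L2R) γ * starRingEnd ℂ ((𝓕 f : L2R) γ) := by
  rw [← Lp.inner_fourier_eq, L2.inner_def]
  rfl

/-- A multiplier invariant under dilation by `a` commutes with the formation of wavelet systems. -/
theorem inner_waveletSystem_fourierMultiplier {a : ℝ} (ha : 0 < a) (β : ℝ) {m : ℝ → ℝ}
    (hm : MemLp (fun γ => (m γ : ℂ)) ∞ volume) (hinv : ∀ (j : ℤ) γ, m ((a ^ j)⁻¹ * γ) = m γ)
    (φ f : L2R) (p : ℤ × ℤ) :
    inner ℂ (waveletSystem a ha β (fourierMultiplier _ hm φ) p) f =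
      inner ℂ (waveletSystem a ha β φ p) (fourierMultiplier _ hm f) := by
  obtain ⟨j, k⟩ := p
  rw [inner_eq_integral_fourier, inner_eq_integral_fourier]
  refine integral_congr_ae ?_
  filter_upwards [fourier_waveletSystem a ha β φ j k,
    fourier_waveletSystem a ha β (fourierMultiplier _ hm φ) j k,
    fourier_fourierMultiplier _ hm f,
    (quasiMeasurePreserving_mul_left (inv_pos.2 (zpow_pos ha j)).ne').ae
      (fourier_fourierMultiplier _ hm φ)] with γ h1 h2 h3 h4
  rw [h1, h2, h3, h4, hinv]
  simp only [map_mul, Complex.conj_ofReal]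
  ring

/-! ### Wavelet systems with truncated generators -/

theorem translation_sub (t : ℝ) (f g : L2R) :
    translation t (f - g) = translation t f - translation t g := by
  refine Lp.ext ?_
  filter_upwards [coeFn_translation t (f - g), coeFn_translation t f, coeFn_translation t g,
    Lp.coeFn_sub (translation t f) (translation t g),
    (measurePreserving_sub_right volume t).quasiMeasurePreserving.ae (Lp.coeFn_sub f g)]
    with x h1 h2 h3 h4 h5
  rw [h1, h4, Pi.sub_apply, h2, h3, h5, Pi.sub_apply]

theorem waveletSystem_sub (a : ℝ) (ha : 0 < a) (β : ℝ) (φ χ : L2R) (p : ℤ × ℤ) :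
    waveletSystem a ha β (φ - χ) p = waveletSystem a ha β φ p - waveletSystem a ha β χ p := by
  simp only [waveletSystem, translation_sub, dilation_sub]

theorem energyDensity_eq (a : ℝ) (φ : L2R) (γ : ℝ) :
    energyDensity a φ γ = ∑' k : ℤ, ‖(𝓕 φ : L2R) (a ^ k * γ)‖ₑ ^ 2 := by
  rw [energyDensity, ← (Equiv.neg ℤ).tsum_eq]
  simp

theorem toReal_energyDensity (a : ℝ) (φ : L2R) (γ : ℝ) :
    (energyDensity a φ γ).toReal = dilationSquareSum a φ γ := by
  rw [energyDensity_eq, ENNReal.tsum_toReal_eq (by simp), dilationSquareSum]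
  simp

theorem summable_of_energyDensity_ne_top {a : ℝ} {φ : L2R} {γ : ℝ}
    (h : energyDensity a φ γ ≠ ∞) :
    Summable fun k : ℤ => ‖(𝓕 φ : L2R) (a ^ k * γ)‖ ^ 2 := by
  rw [energyDensity_eq] at h
  simpa using ENNReal.summable_toReal h

theorem dilationSquareSum_zpow_mul {a : ℝ} (ha : 0 < a) (φ : L2R) (j : ℤ) (γ : ℝ) :
    dilationSquareSum a φ ((a ^ j)⁻¹ * γ) = dilationSquareSum a φ γ := by
  rw [dilationSquareSum, ← (Equiv.addRight j).tsum_eq, dilationSquareSum]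
  refine tsum_congr fun k => ?_
  rw [Equiv.coe_addRight, zpow_add₀ ha.ne', mul_assoc, mul_inv_cancel_left₀ (zpow_pos ha j).ne']

theorem measurable_dilationSquareSum (a : ℝ) (φ : L2R) : Measurable (dilationSquareSum a φ) := by
  have h := (measurable_energyDensity a φ).ennreal_toReal
  simpa only [toReal_energyDensity] using h

theorem energyDensity_truncation_add {a : ℝ} (ha : 0 < a) (K : ℝ) (ψ : L2R) :
    ∀ᵐ γ : ℝ, energyDensity a ψ γ =
      energyDensity a (truncation K ψ) γ + energyDensity a (ψ - truncation K ψ) γ := by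
  have h : ∀ᵐ γ : ℝ, ‖(𝓕 ψ : L2R) γ‖ₑ ^ 2 = ‖(𝓕 (truncation K ψ) : L2R) γ‖ₑ ^ 2 +
      ‖(𝓕 (ψ - truncation K ψ) : L2R) γ‖ₑ ^ 2 := by
    filter_upwards [fourier_truncation K ψ, fourier_sub_truncation K ψ] with γ h1 h2
    rw [h1, h2]
    by_cases hγ : γ ∈ Set.Icc (-K) K
    · rw [Set.indicator_of_mem hγ, Set.indicator_of_notMem (by simpa using hγ)]
      simp
    · rw [Set.indicator_of_notMem hγ, Set.indicator_of_mem (by simpa using hγ)]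
      simp
  filter_upwards [ae_all_iff.2 fun j : ℤ =>
    (quasiMeasurePreserving_mul_left (inv_pos.2 (zpow_pos ha j)).ne').ae h] with γ hγ
  simp only [energyDensity, ← ENNReal.tsum_add, hγ]

/-- If `U W†` is closer than `1` to the identity, then so is `W U†`, hence the analysis operator
`U†` is bounded below. -/
theorem isFrame_of_norm_id_sub_lt_one {ι H : Type} [NormedAddCommGroup H]
    [InnerProductSpace ℂ H] [CompleteSpace H] {f : ι → H} {U W : ell2 ι →L[ℂ] H}
    (hU : IsSynthesisOperator f U)
    (h : ‖ContinuousLinearMap.id ℂ H - U ∘L ContinuousLinearMap.adjoint W‖ < 1) : IsFrame f := by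
  set r := ‖ContinuousLinearMap.id ℂ H - U ∘L ContinuousLinearMap.adjoint W‖ with hr
  have h1 : ‖ContinuousLinearMap.id ℂ H - W ∘L ContinuousLinearMap.adjoint U‖ = r := by
    rw [hr, ← (ContinuousLinearMap.adjoint (𝕜 := ℂ)).norm_map
      (ContinuousLinearMap.id ℂ H - U ∘L ContinuousLinearMap.adjoint W), map_sub,
      ContinuousLinearMap.adjoint_comp, ContinuousLinearMap.adjoint_adjoint,
      ContinuousLinearMap.adjoint_id]
  have h2 : ∀ x, (1 - r) * ‖x‖ ≤ (‖W‖ + 1) * ‖ContinuousLinearMap.adjoint U x‖ := fun x => by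
    have h3 := (ContinuousLinearMap.id ℂ H - W ∘L ContinuousLinearMap.adjoint U).le_opNorm x
    rw [h1] at h3
    simp only [sub_apply, ContinuousLinearMap.id_apply,
      ContinuousLinearMap.comp_apply] at h3
    have h4 := norm_sub_norm_le x (W (ContinuousLinearMap.adjoint U x))
    have h5 := W.le_opNorm (ContinuousLinearMap.adjoint U x)
    have h6 := norm_nonneg (ContinuousLinearMap.adjoint U x)
    linarith
  refine ⟨((1 - r) / (‖W‖ + 1)) ^ 2, ‖ContinuousLinearMap.adjoint U‖ ^ 2,
    isFrameWithBounds_of_frameEnergy_bounds (pow_pos (div_pos (by linarith) (by positivity)) 2)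
      (by positivity) (fun x => ?_) fun x => ?_⟩
  · rw [← hU.enorm_adjoint_sq, enorm_sq_eq_ofReal, enorm_sq_eq_ofReal,
      ← ENNReal.ofReal_mul (by positivity), ← mul_pow]
    refine ENNReal.ofReal_le_ofReal (pow_le_pow_left₀ ?_ ?_ 2)
    · exact mul_nonneg (div_nonneg (by linarith) (by positivity)) (norm_nonneg _)
    · rw [div_mul_eq_mul_div, div_le_iff₀ (by positivity), mul_comm _ (‖W‖ + 1)]
      exact h2 x
  · rw [← hU.enorm_adjoint_sq, enorm_sq_eq_ofReal, enorm_sq_eq_ofReal,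
      ← ENNReal.ofReal_mul (by positivity), ← mul_pow]
    exact ENNReal.ofReal_le_ofReal
      (pow_le_pow_left₀ (norm_nonneg _) (ContinuousLinearMap.le_opNorm _ x) 2)

/-! ### The oversampling factor and the error constant -/

theorem existsUnique_isOversamplingFactor (b : ℝ) (K : ℕ) :
    ∃! N : ℤ, IsOversamplingFactor b K N := by
  set n : ℤ := ⌊(2 * b * K + 1) / 2⌋ with hn
  have h1 := Int.floor_le ((2 * b * K + 1) / 2)
  have h2 := Int.lt_floor_add_one ((2 * b * K + 1) / 2)
  rw [← hn] at h1 h2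
  refine ⟨2 * n + 1, ⟨⟨n, rfl⟩, by push_cast; linarith, by push_cast; linarith⟩, ?_⟩
  rintro N ⟨⟨k, rfl⟩, h3, h4⟩
  push_cast at h3 h4
  have h5 : n = k := by
    rw [hn, Int.floor_eq_iff]
    constructor <;> linarith
  rw [h5]

theorem IsOversamplingFactor.pos {b : ℝ} (hb : 0 < b) {K : ℕ} {N : ℤ}
    (h : IsOversamplingFactor b K N) : (0 : ℝ) < N :=
  lt_of_le_of_lt (by positivity) h.2.2

theorem tendsto_errorConstant (a C : ℝ) {b σ : ℝ} (hσ : 0 < σ) :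
    Tendsto (fun K : ℕ => errorConstant a b C σ K) atTop (𝓝 0) := by
  have h1 : Tendsto (fun x : ℝ => (x + 1 / b) / x ^ (3 + 2 * σ)) atTop (𝓝 0) := by
    have h2 := (tendsto_rpow_neg_atTop (show 0 < 2 + 2 * σ by linarith)).add
      ((tendsto_rpow_neg_atTop (show 0 < 3 + 2 * σ by linarith)).const_mul (1 / b))
    rw [mul_zero, add_zero] at h2
    refine h2.congr' ?_
    filter_upwards [eventually_gt_atTop 0] with x hx
    have h3 : x ^ (-(2 + 2 * σ)) = x ^ (-(3 + 2 * σ)) * x := by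
      rw [show -(2 + 2 * σ) = -(3 + 2 * σ) + 1 by ring, Real.rpow_add hx, Real.rpow_one]
    rw [h3, Real.rpow_neg hx.le, div_eq_mul_inv]
    ring
  have h4 := ((h1.comp tendsto_natCast_atTop_atTop).sqrt.mul_const (2 * C)).mul_const
    √((1 + 1 / (2 * σ)) * (a ^ (1 + σ) / (a ^ (1 + σ) - 1)))
  rw [Real.sqrt_zero, zero_mul, zero_mul] at h4
  exact h4

theorem errorConstant_nonneg (a : ℝ) {b C σ : ℝ} (hC : 0 < C) (K : ℕ) :
    0 ≤ errorConstant a b C σ K := by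
  unfold errorConstant; positivity

/-- The error constant dominates the bounds for the tail of the generator. -/
theorem le_errorConstant_sq {a b C σ : ℝ} (ha : 1 < a) (hb : 0 < b) (hσ : 0 < σ)
    {K : ℕ} (hK : 1 ≤ K) :
    4 * C ^ 2 * ((K : ℝ) ^ (-(1 + σ))) ^ 2 *
      ((1 + 1 / (2 * σ)) * (a ^ (1 + σ) / (a ^ (1 + σ) - 1))) ≤ errorConstant a b C σ K ^ 2 := by
  have hK0 : (0 : ℝ) < K := by exact_mod_cast hK
  have has : 0 < a ^ (1 + σ) - 1 := sub_pos.2 (Real.one_lt_rpow ha (by linarith))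
  have ha0 : 0 < a := by linarith
  have h1 : ((K : ℝ) ^ (-(1 + σ))) ^ 2 ≤ ((K : ℝ) + 1 / b) / (K : ℝ) ^ (3 + 2 * σ) := by
    have h2 : ((K : ℝ) ^ (-(1 + σ))) ^ 2 = K / (K : ℝ) ^ (3 + 2 * σ) := by
      rw [← Real.rpow_natCast, ← Real.rpow_mul hK0.le, div_eq_mul_inv, ← Real.rpow_neg hK0.le]
      nth_rw 2 [← Real.rpow_one (K : ℝ)]
      rw [← Real.rpow_add hK0]
      congr 1
      push_cast
      ring
    rw [h2]
    gcongr
    have : 0 < 1 / b := by positivity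
    linarith
  rw [errorConstant, mul_pow, mul_pow, Real.sq_sqrt (by positivity), Real.sq_sqrt (by positivity)]
  calc _ = ((K : ℝ) ^ (-(1 + σ))) ^ 2 * (2 * C) ^ 2 *
        ((1 + 1 / (2 * σ)) * (a ^ (1 + σ) / (a ^ (1 + σ) - 1))) := by ring
    _ ≤ _ := by gcongr

/-! ### The canonical dual of a band-limited generator -/

section Dual

variable {a β c₀ c₁ : ℝ} {φ : L2R}

theorem memLp_dualMultiplier (hβ : 0 < β) (hc₀ : 0 < c₀)
    (hlow : ∀ᵐ γ : ℝ, c₀ ≤ dilationSquareSum a φ γ) :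
    MemLp (fun γ => ((β / dilationSquareSum a φ γ : ℝ) : ℂ)) ∞ volume := by
  have hm := measurable_dilationSquareSum a φ
  refine memLp_top_of_bound
    (Complex.measurable_ofReal.comp (measurable_const.div hm)).aestronglyMeasurable (β / c₀) ?_
  filter_upwards [hlow] with γ hγ
  rw [Complex.norm_real, Real.norm_of_nonneg (div_nonneg hβ.le (hc₀.le.trans hγ))]
  gcongr

theorem memLp_frameMultiplier (hβ : 0 < β) (hc₀ : 0 < c₀)
    (hlow : ∀ᵐ γ : ℝ, c₀ ≤ dilationSquareSum a φ γ)
    (hup : ∀ᵐ γ : ℝ, dilationSquareSum a φ γ ≤ c₁) :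
    MemLp (fun γ => ((dilationSquareSum a φ γ / β : ℝ) : ℂ)) ∞ volume := by
  have hm := measurable_dilationSquareSum a φ
  refine memLp_top_of_bound
    (Complex.measurable_ofReal.comp (hm.div_const β)).aestronglyMeasurable (c₁ / β) ?_
  filter_upwards [hlow, hup] with γ h1 h2
  rw [Complex.norm_real, Real.norm_of_nonneg (div_nonneg (hc₀.le.trans h1) hβ.le)]
  gcongr

/-- The frame operator of an oversampled band-limited wavelet system is a Fourier multiplier. -/
theorem frameEnergy_eq_lintegral_dilationSquareSum {K : ℝ} (ha : 0 < a) (hβ : 0 < β)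
    (hK : 2 * K < 1 / β) (hφ : MemLp (𝓕 φ : L2R) ∞ volume)
    (hsupp : ∀ᵐ γ : ℝ, γ ∉ Set.Icc (-K) K → (𝓕 φ : L2R) γ = 0)
    (hfin : ∀ᵐ γ : ℝ, energyDensity a φ γ ≠ ∞) (f : L2R) :
    frameEnergy (waveletSystem a ha β φ) f =
      ∫⁻ γ, ENNReal.ofReal (dilationSquareSum a φ γ / β) * ‖(𝓕 f : L2R) γ‖ₑ ^ 2 := by
  rw [frameEnergy_eq_of_bandlimited ha hβ hK hφ hsupp,
    ← lintegral_const_mul' _ _ ENNReal.ofReal_ne_top]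
  refine lintegral_congr_ae ?_
  filter_upwards [hfin] with γ hγ
  have h : dilationSquareSum a φ γ / β = 1 / β * dilationSquareSum a φ γ := by ring
  rw [h, ENNReal.ofReal_mul (by positivity), ← toReal_energyDensity, ENNReal.ofReal_toReal hγ,
    mul_assoc]

/-- The analysis of `f` by the dual system is the analysis of a multiplied `f` by the original
system, so its energy is a weighted norm of `f` with the reciprocal weight. -/
theorem frameEnergy_dual_eq_lintegral {K : ℝ} (ha : 0 < a) (hβ : 0 < β)
    (hK : 2 * K < 1 / β) (hφ : MemLp (𝓕 φ : L2R) ∞ volume)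
    (hsupp : ∀ᵐ γ : ℝ, γ ∉ Set.Icc (-K) K → (𝓕 φ : L2R) γ = 0)
    (hfin : ∀ᵐ γ : ℝ, energyDensity a φ γ ≠ ∞) (hc₀ : 0 < c₀)
    (hlow : ∀ᵐ γ : ℝ, c₀ ≤ dilationSquareSum a φ γ) (f : L2R) :
    frameEnergy (waveletSystem a ha β
        (fourierMultiplier _ (memLp_dualMultiplier hβ hc₀ hlow) φ)) f =
      ∫⁻ γ, ENNReal.ofReal (β / dilationSquareSum a φ γ) * ‖(𝓕 f : L2R) γ‖ₑ ^ 2 := by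
  have h1 : frameEnergy (waveletSystem a ha β
        (fourierMultiplier _ (memLp_dualMultiplier hβ hc₀ hlow) φ)) f =
      frameEnergy (waveletSystem a ha β φ)
        (fourierMultiplier _ (memLp_dualMultiplier hβ hc₀ hlow) f) := by
    simp only [frameEnergy]
    refine tsum_congr fun p => ?_
    rw [inner_waveletSystem_fourierMultiplier ha β (memLp_dualMultiplier hβ hc₀ hlow)
      (fun j γ => by rw [dilationSquareSum_zpow_mul ha])]
  rw [h1, frameEnergy_eq_lintegral_dilationSquareSum ha hβ hK hφ hsupp hfin]
  refine lintegral_congr_ae ?_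
  filter_upwards [hlow, fourier_fourierMultiplier _ (memLp_dualMultiplier hβ hc₀ hlow) f]
    with γ h2 h3
  have h4 : 0 < dilationSquareSum a φ γ := hc₀.trans_le h2
  rw [h3, enorm_mul, mul_pow, ← mul_assoc, enorm_sq_eq_ofReal, Complex.norm_real,
    Real.norm_of_nonneg (by positivity), ← ENNReal.ofReal_mul (by positivity)]
  congr 2
  field_simp

theorem lintegral_weight_le {w : ℝ → ℝ} {c : ℝ} (h : ∀ᵐ γ : ℝ, w γ ≤ c) (f : L2R) :
    ∫⁻ γ, ENNReal.ofReal (w γ) * ‖(𝓕 f : L2R) γ‖ₑ ^ 2 ≤ ENNReal.ofReal c * ‖f‖ₑ ^ 2 := by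
  rw [enorm_sq_eq_lintegral_fourier, ← lintegral_const_mul' _ _ ENNReal.ofReal_ne_top]
  refine lintegral_mono_ae ?_
  filter_upwards [h] with γ hγ
  gcongr

theorem le_lintegral_weight {w : ℝ → ℝ} {c : ℝ} (h : ∀ᵐ γ : ℝ, c ≤ w γ) (f : L2R) :
    ENNReal.ofReal c * ‖f‖ₑ ^ 2 ≤ ∫⁻ γ, ENNReal.ofReal (w γ) * ‖(𝓕 f : L2R) γ‖ₑ ^ 2 := by
  rw [enorm_sq_eq_lintegral_fourier, ← lintegral_const_mul' _ _ ENNReal.ofReal_ne_top]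
  refine lintegral_mono_ae ?_
  filter_upwards [h] with γ hγ
  gcongr

/-- Exact reconstruction: the band-limited system and its dual satisfy `U W† = 1`. -/
theorem synthesis_comp_adjoint_dual_eq_id {K : ℝ} (ha : 0 < a) (hβ : 0 < β)
    (hK : 2 * K < 1 / β) (hφ : MemLp (𝓕 φ : L2R) ∞ volume)
    (hsupp : ∀ᵐ γ : ℝ, γ ∉ Set.Icc (-K) K → (𝓕 φ : L2R) γ = 0)
    (hfin : ∀ᵐ γ : ℝ, energyDensity a φ γ ≠ ∞) (hc₀ : 0 < c₀)
    (hlow : ∀ᵐ γ : ℝ, c₀ ≤ dilationSquareSum a φ γ)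
    (hup : ∀ᵐ γ : ℝ, dilationSquareSum a φ γ ≤ c₁)
    {U W : ell2 (ℤ × ℤ) →L[ℂ] L2R}
    (hU : IsSynthesisOperator (waveletSystem a ha β φ) U)
    (hW : IsSynthesisOperator (waveletSystem a ha β
        (fourierMultiplier _ (memLp_dualMultiplier hβ hc₀ hlow) φ)) W) :
    U ∘L ContinuousLinearMap.adjoint W = ContinuousLinearMap.id ℂ L2R := by
  set D := fourierMultiplier _ (memLp_dualMultiplier hβ hc₀ hlow) with hD
  set S := fourierMultiplier _ (memLp_frameMultiplier hβ hc₀ hlow hup) with hS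
  -- the frame operator `U U†` is the multiplier `S`, since the quadratic forms agree
  have hUU : ∀ x, U (ContinuousLinearMap.adjoint U x) = S x := by
    have key : ((U ∘L ContinuousLinearMap.adjoint U : L2R →L[ℂ] L2R) : L2R →ₗ[ℂ] L2R) =
        (S : L2R →ₗ[ℂ] L2R) := by
      refine (ext_inner_map _ _).1 fun x => ?_
      change inner ℂ (U (ContinuousLinearMap.adjoint U x)) x = inner ℂ (S x) x
      rw [← ContinuousLinearMap.adjoint_inner_right, inner_self_eq_norm_sq_to_K,
        inner_eq_integral_fourier]
      have h1 : ∫ γ, (𝓕 x : L2R) γ * starRingEnd ℂ ((𝓕 (S x) : L2R) γ) =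
          ∫ γ, ((dilationSquareSum a φ γ / β * ‖(𝓕 x : L2R) γ‖ ^ 2 : ℝ) : ℂ) := by
        refine integral_congr_ae ?_
        filter_upwards [fourier_fourierMultiplier _ (memLp_frameMultiplier hβ hc₀ hlow hup) x]
          with γ hγ
        rw [hγ, map_mul, Complex.conj_ofReal, mul_left_comm, Complex.mul_conj,
          Complex.normSq_eq_norm_sq, ← Complex.ofReal_mul]
      have hmx := measurable_fourier x
      have hmφ := measurable_dilationSquareSum a φ
      have h2 : ‖ContinuousLinearMap.adjoint U x‖ ^ 2 =
          ∫ γ, dilationSquareSum a φ γ / β * ‖(𝓕 x : L2R) γ‖ ^ 2 := by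
        have h3 := hU.enorm_adjoint_sq x
        rw [frameEnergy_eq_lintegral_dilationSquareSum ha hβ hK hφ hsupp hfin] at h3
        rw [integral_eq_lintegral_of_nonneg_ae ?_ (by fun_prop)]
        · rw [← toReal_enorm (ContinuousLinearMap.adjoint U x), ← ENNReal.toReal_pow, h3]
          congr 1
          refine lintegral_congr_ae ?_
          filter_upwards [hlow] with γ hγ
          rw [ENNReal.ofReal_mul (div_nonneg (hc₀.le.trans hγ) hβ.le), enorm_sq_eq_ofReal]
        · filter_upwards [hlow] with γ hγ
          exact mul_nonneg (div_nonneg (hc₀.le.trans hγ) hβ.le) (by positivity)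
      rw [h1, integral_complex_ofReal, ← h2]
      simp
    exact fun x => congrArg (fun T : L2R →ₗ[ℂ] L2R => T x) key
  ext1 f
  have h1 : ContinuousLinearMap.adjoint W f = ContinuousLinearMap.adjoint U (D f) := by
    ext p
    rw [hW.adjoint_apply, hU.adjoint_apply, hD,
      inner_waveletSystem_fourierMultiplier ha β (memLp_dualMultiplier hβ hc₀ hlow)
      (fun j γ => by rw [dilationSquareSum_zpow_mul ha])]
  rw [ContinuousLinearMap.comp_apply, h1, hUU, ContinuousLinearMap.id_apply]
  refine (Lp.fourierTransformₗᵢ ℝ ℂ).injective (Lp.ext ?_)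
  change (𝓕 (S (D f)) : L2R) =ᵐ[volume] (𝓕 f : L2R)
  filter_upwards [fourier_fourierMultiplier _ (memLp_frameMultiplier hβ hc₀ hlow hup) (D f),
    fourier_fourierMultiplier _ (memLp_dualMultiplier hβ hc₀ hlow) f, hlow] with γ h2 h3 h4
  have h5 : dilationSquareSum a φ γ ≠ 0 := (hc₀.trans_le h4).ne'
  rw [h2, h3, ← mul_assoc, ← Complex.ofReal_mul, div_mul_div_cancel₀ hβ.ne', div_self h5,
    Complex.ofReal_one, one_mul]

end Dual

/-! ### Approximate reconstruction with the truncated generator -/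

/-- Removing the tail of the generator costs at most `ε_K² / 2` of the lower bound `b A`. -/
theorem dilationSquareSum_truncation_bounds {a b : ℝ} (ha : 1 < a) (hb : 0 < b) {ψ : L2R}
    {A B : ℝ} (hframe : IsFrameWithBounds (waveletSystem a (zero_lt_one.trans ha) b ψ) A B)
    {C σ : ℝ} (hC : 0 < C) (hσ : 0 < σ) (hdecay : FourierDecay C σ ψ) {K : ℕ} (hK : 1 ≤ K)
    (hlt : errorConstant a b C σ K < √(2 * b * A)) :
    ∀ᵐ γ : ℝ, energyDensity a (truncation K ψ) γ ≠ ∞ ∧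
      (√(2 * b * A) - errorConstant a b C σ K) ^ 2 / 2 ≤
        dilationSquareSum a (truncation K ψ) γ ∧
      dilationSquareSum a (truncation K ψ) γ ≤ b * max B 0 := by
  have hK0 : (0 : ℝ) < K := by exact_mod_cast hK
  have has : 0 < a ^ (1 + σ) - 1 := sub_pos.2 (Real.one_lt_rpow ha (by linarith))
  have ha0 : 0 < a := by linarith
  have hA := hframe.1
  set e := errorConstant a b C σ K
  have he : 0 ≤ e := errorConstant_nonneg a hC K
  filter_upwards [le_energyDensity_of_frame ha hb hframe hC hσ hdecay,
    energyDensity_le_of_frame ha0 hb hframe (hdecay.memLp_top hC),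
    energyDensity_truncation_add ha0 K ψ,
    hdecay.energyDensity_tail_le hC hσ ha hK0] with γ h1 h2 h3 h4
  have h5 : energyDensity a (truncation K ψ) γ ≤ ENNReal.ofReal (b * B) := by
    rw [h3] at h2
    exact le_self_add.trans h2
  have hfin : energyDensity a (truncation K ψ) γ ≠ ∞ := (h5.trans_lt ENNReal.ofReal_lt_top).ne
  rw [← ENNReal.ofReal_toReal hfin, toReal_energyDensity] at h3 h5
  have hnn : 0 ≤ dilationSquareSum a (truncation K ψ) γ := by
    rw [← toReal_energyDensity]; exact ENNReal.toReal_nonneg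
  refine ⟨hfin, ?_, ?_⟩
  · rw [h3] at h1
    grw [h4] at h1
    rw [← ENNReal.ofReal_add hnn (by positivity), ENNReal.ofReal_le_ofReal_iff (by positivity)]
      at h1
    have h6 := le_errorConstant_sq (C := C) ha hb hσ hK
    have h7 : C ^ 2 * ((K : ℝ) ^ (-(1 + σ))) ^ 2 * (a ^ (1 + σ) / (a ^ (1 + σ) - 1)) ≤
        e ^ 2 / 2 := by
      have h8 : 0 ≤ C ^ 2 * ((K : ℝ) ^ (-(1 + σ))) ^ 2 * (a ^ (1 + σ) / (a ^ (1 + σ) - 1)) := by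
        positivity
      have h9 : 0 ≤ 1 / (2 * σ) := by positivity
      nlinarith [mul_nonneg h8 h9]
    have h10 : √(2 * b * A) ^ 2 = 2 * b * A := Real.sq_sqrt (by positivity)
    nlinarith
  · have h6 : b * B ≤ b * max B 0 := by gcongr; exact le_max_left _ _
    have h7 := h5.trans (ENNReal.ofReal_le_ofReal h6)
    exact (ENNReal.ofReal_le_ofReal_iff (by positivity)).1 h7

/-- The Bessel bound of the oversampled system generated by the tail `ψ - ψ_K`. -/
theorem frameEnergy_tail_le {a b : ℝ} (ha : 1 < a) (hb : 0 < b) {ψ : L2R}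
    {C σ : ℝ} (hC : 0 < C) (hσ : 0 < σ) (hdecay : FourierDecay C σ ψ) {K : ℕ} (hK : 1 ≤ K)
    {N : ℤ} (hN : IsOversamplingFactor b K N) (f : L2R) :
    frameEnergy (waveletSystem a (zero_lt_one.trans ha) (b / N) (ψ - truncation K ψ)) f ≤
      ENNReal.ofReal (N / (2 * b) * errorConstant a b C σ K ^ 2) * ‖f‖ₑ ^ 2 := by
  have hK0 : (0 : ℝ) < K := by exact_mod_cast hK
  have has : 0 < a ^ (1 + σ) - 1 := sub_pos.2 (Real.one_lt_rpow ha (by linarith))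
  have ha0 : 0 < a := by linarith
  have hN0 := hN.pos hb
  have hβ : 0 < b / N := by positivity
  refine (frameEnergy_le_of_tsum_le ha0 hβ ENNReal.ofReal_ne_top
    (hdecay.tsum_tail_lattice_le hC hσ hK0 hβ)
    (hdecay.tsum_tail_dilation_le hC hσ ha hK0) f).trans ?_
  rw [← ENNReal.ofReal_mul (by positivity), ← ENNReal.ofReal_mul (by positivity)]
  refine mul_le_mul' (ENNReal.ofReal_le_ofReal ?_) le_rfl
  -- the dual lattice has spacing `N / b > 2 K`
  have h1 : K * (b / N) / σ ≤ 1 / (2 * σ) := by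
    rw [div_le_div_iff₀ hσ (by positivity), mul_div_assoc', div_mul_eq_mul_div,
      div_le_iff₀ hN0]
    nlinarith [hN.2.2]
  calc 1 / (b / N) * (2 * C * ((K : ℝ) ^ (-(1 + σ)) * (1 + K * (b / N) / σ)) *
        (C * ((K : ℝ) ^ (-(1 + σ)) * (a ^ (1 + σ) / (a ^ (1 + σ) - 1)))))
      ≤ 1 / (b / N) * (2 * C * ((K : ℝ) ^ (-(1 + σ)) * (1 + 1 / (2 * σ))) *
        (C * ((K : ℝ) ^ (-(1 + σ)) * (a ^ (1 + σ) / (a ^ (1 + σ) - 1))))) := by gcongr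
    _ = N / (2 * b) * (4 * C ^ 2 * ((K : ℝ) ^ (-(1 + σ))) ^ 2 *
        ((1 + 1 / (2 * σ)) * (a ^ (1 + σ) / (a ^ (1 + σ) - 1)))) := by
      rw [one_div_div]
      ring
    _ ≤ _ := by
      gcongr
      exact le_errorConstant_sq ha hb hσ hK

theorem eventually_errorConstant_admissible {a b A C σ ε : ℝ} (hb : 0 < b) (hA : 0 < A)
    (hσ : 0 < σ) (hε : 0 < ε) :
    ∀ᶠ K : ℕ in atTop, errorConstant a b C σ K < √(2 * b * A) ∧
      errorConstant a b C σ K / (√(2 * b * A) - errorConstant a b C σ K) ≤ ε := by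
  have hs : 0 < √(2 * b * A) := Real.sqrt_pos.2 (by positivity)
  have h1 := tendsto_errorConstant a C (b := b) hσ
  have h2 := h1.div (h1.const_sub √(2 * b * A)) (by simpa using hs.ne')
  rw [zero_div] at h2
  filter_upwards [h1.eventually_lt_const hs, h2.eventually_lt_const hε] with K h3 h4
  exact ⟨h3, h4.le⟩

/-- The properties of the dual generator for an admissible truncation parameter `K`. -/
theorem exists_approximate_dual {a b : ℝ} (ha : 1 < a) (hb : 0 < b) {ψ : L2R}
    {A B : ℝ} (hframe : IsFrameWithBounds (waveletSystem a (zero_lt_one.trans ha) b ψ) A B)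
    {C σ : ℝ} (hC : 0 < C) (hσ : 0 < σ) (hdecay : FourierDecay C σ ψ) {ε : ℝ} {K : ℕ} (hK : 1 ≤ K)
    (hlt : errorConstant a b C σ K < √(2 * b * A))
    (hle : errorConstant a b C σ K / (√(2 * b * A) - errorConstant a b C σ K) ≤ ε)
    {N : ℤ} (hN : IsOversamplingFactor b K N) :
    ∃ ψd : L2R, (𝓕 ψd : L2R) =ᵐ[volume] dualGeneratorFourier a b N K ψ ∧
      IsFrame (waveletSystem a (zero_lt_one.trans ha) (b / N) ψd) ∧
      (ε < 1 → IsFrame (waveletSystem a (zero_lt_one.trans ha) (b / N) ψ)) ∧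
      ∃ U W : ell2 (ℤ × ℤ) →L[ℂ] L2R,
        IsSynthesisOperator (waveletSystem a (zero_lt_one.trans ha) (b / N) ψ) U ∧
        IsSynthesisOperator (waveletSystem a (zero_lt_one.trans ha) (b / N) ψd) W ∧
        ‖ContinuousLinearMap.id ℂ L2R - U ∘L ContinuousLinearMap.adjoint W‖ ≤ ε := by
  have ha0 : 0 < a := zero_lt_one.trans ha
  have hN0 := hN.pos hb
  set β : ℝ := b / N with hβ_def
  have hβ : 0 < β := by positivity
  set e := errorConstant a b C σ K with he_def
  set s := √(2 * b * A)
  have he : 0 ≤ e := errorConstant_nonneg a hC K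
  have hse : 0 < s - e := by linarith
  set φ := truncation K ψ
  set c₀ := (s - e) ^ 2 / 2 with hc₀_def
  set c₁ := b * max B 0
  have hc₀ : 0 < c₀ := by positivity
  have hbounds := dilationSquareSum_truncation_bounds ha hb hframe hC hσ hdecay hK hlt
  have hfin : ∀ᵐ γ : ℝ, energyDensity a φ γ ≠ ∞ := hbounds.mono fun _ h => h.1
  have hlow : ∀ᵐ γ : ℝ, c₀ ≤ dilationSquareSum a φ γ := hbounds.mono fun _ h => h.2.1
  have hup : ∀ᵐ γ : ℝ, dilationSquareSum a φ γ ≤ c₁ := hbounds.mono fun _ h => h.2.2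
  have hc₁ : 0 < c₁ := by
    obtain ⟨γ, h1, h2⟩ := (hlow.and hup).exists
    exact hc₀.trans_le (h1.trans h2)
  have hφ : MemLp (𝓕 φ : L2R) ∞ volume := memLp_top_truncation _ (hdecay.memLp_top hC)
  have hsupp : ∀ᵐ γ : ℝ, γ ∉ Set.Icc (-(K : ℝ)) K → (𝓕 φ : L2R) γ = 0 := by
    filter_upwards [fourier_truncation K ψ] with γ h1 h2
    rw [h1, Set.indicator_of_notMem h2]
  have hKβ : 2 * (K : ℝ) < 1 / β := by
    rw [hβ_def, one_div_div, lt_div_iff₀ hb]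
    linarith [hN.2.2]
  set ψd := fourierMultiplier _ (memLp_dualMultiplier hβ hc₀ hlow) φ with hψd
  have hdual := frameEnergy_dual_eq_lintegral ha0 hβ hKβ hφ hsupp hfin hc₀ hlow
  have hdual_le : ∀ f, frameEnergy (waveletSystem a ha0 β ψd) f ≤
      ENNReal.ofReal (β / c₀) * ‖f‖ₑ ^ 2 := fun f => by
    rw [hdual]
    refine lintegral_weight_le ?_ f
    filter_upwards [hlow] with γ hγ
    gcongr
  have hdual_ge : ∀ f, ENNReal.ofReal (β / c₁) * ‖f‖ₑ ^ 2 ≤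
      frameEnergy (waveletSystem a ha0 β ψd) f := fun f => by
    rw [hdual]
    refine le_lintegral_weight ?_ f
    filter_upwards [hlow, hup] with γ h1 h2
    have := hc₀.trans_le h1
    gcongr
  have htrunc_le : ∀ f, frameEnergy (waveletSystem a ha0 β φ) f ≤
      ENNReal.ofReal (c₁ / β) * ‖f‖ₑ ^ 2 := fun f => by
    rw [frameEnergy_eq_lintegral_dilationSquareSum ha0 hβ hKβ hφ hsupp hfin]
    refine lintegral_weight_le ?_ f
    filter_upwards [hup] with γ hγ
    gcongr
  have htail_le := frameEnergy_tail_le ha hb hC hσ hdecay hK hN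
  obtain ⟨W, hW⟩ := exists_isSynthesisOperator hdual_le
  obtain ⟨V, hV⟩ := exists_isSynthesisOperator htrunc_le
  obtain ⟨G, hG⟩ := exists_isSynthesisOperator htail_le
  have hU : IsSynthesisOperator (waveletSystem a ha0 β ψ) (V + G) := fun c => by
    have h1 := (hV c).add (hG c)
    refine h1.congr_fun fun p => ?_
    rw [← smul_add, waveletSystem_sub, add_sub_cancel]
  have hVW := synthesis_comp_adjoint_dual_eq_id ha0 hβ hKβ hφ hsupp hfin hc₀ hlow hup hV hW
  -- by exact reconstruction with `V`, only the contribution of the tail is left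
  have hdiff : ContinuousLinearMap.id ℂ L2R - (V + G) ∘L ContinuousLinearMap.adjoint W =
      -(G ∘L ContinuousLinearMap.adjoint W) := by
    rw [ContinuousLinearMap.add_comp, hVW]
    abel
  have hnorm : ‖ContinuousLinearMap.id ℂ L2R - (V + G) ∘L ContinuousLinearMap.adjoint W‖ ≤ ε := by
    rw [hdiff, norm_neg]
    refine le_trans ?_ hle
    calc ‖G ∘L ContinuousLinearMap.adjoint W‖ ≤ ‖G‖ * ‖ContinuousLinearMap.adjoint W‖ :=
          ContinuousLinearMap.opNorm_comp_le _ _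
      _ ≤ √(N / (2 * b) * e ^ 2) * √(β / c₀) := by
          rw [(ContinuousLinearMap.adjoint (𝕜 := ℂ)).norm_map W]
          gcongr
          · exact hG.norm_le htail_le
          · exact hW.norm_le hdual_le
      _ = √((e / (s - e)) ^ 2) := by
          rw [← Real.sqrt_mul (by positivity)]
          congr 1
          rw [hc₀_def, hβ_def]
          field_simp
      _ = e / (s - e) := Real.sqrt_sq (by positivity)
  refine ⟨ψd, ?_, ⟨_, _, isFrameWithBounds_of_frameEnergy_bounds (div_pos hβ hc₁) (by positivity)
    hdual_ge hdual_le⟩, fun hε1 => isFrame_of_norm_id_sub_lt_one hU (hnorm.trans_lt hε1),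
    V + G, W, hU, hW, hnorm⟩
  filter_upwards [fourier_fourierMultiplier _ (memLp_dualMultiplier hβ hc₀ hlow) φ] with γ h1
  rw [h1, dualGeneratorFourier, hβ_def]
  push_cast
  rw [div_div, div_mul_eq_mul_div]

end OversampledWavelet

end

theorem mainTheorem5 (a b : ℝ) (ha : 1 < a) (hb : 0 < b)
    (ψ : OversampledWavelet.L2R) (A B : ℝ)
    (hframe : OversampledWavelet.IsFrameWithBounds
      (OversampledWavelet.waveletSystem a (zero_lt_one.trans ha) b ψ) A B)
    (C σ : ℝ) (hC : 0 < C) (hσ : 0 < σ)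
    (hdecay : ∀ᵐ γ : ℝ, ‖(𝓕 ψ : OversampledWavelet.L2R) γ‖ ≤ C / (1 + |γ| ^ (1 + σ)))
    (ε : ℝ) (hε : 0 < ε) :
    -- all sufficiently large `K` are admissible
    (∀ᶠ K : ℕ in atTop,
      OversampledWavelet.errorConstant a b C σ K < √(2 * b * A) ∧
      OversampledWavelet.errorConstant a b C σ K /
        (√(2 * b * A) - OversampledWavelet.errorConstant a b C σ K) ≤ ε) ∧
    -- every admissible `K ≥ 1` works
    ∀ K : ℕ, 1 ≤ K →
      OversampledWavelet.errorConstant a b C σ K < √(2 * b * A) →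
      OversampledWavelet.errorConstant a b C σ K /
        (√(2 * b * A) - OversampledWavelet.errorConstant a b C σ K) ≤ ε →
      (∃! N : ℤ, OversampledWavelet.IsOversamplingFactor b K N) ∧
      ∀ N : ℤ, OversampledWavelet.IsOversamplingFactor b K N →
        -- the denominator in the definition of the dual generator is a.e. finite and nonzero
        (∀ᵐ γ : ℝ,
          Summable (fun k : ℤ =>
            ‖(𝓕 (OversampledWavelet.truncation K ψ) : OversampledWavelet.L2R) (a ^ k * γ)‖ ^ 2) ∧
          0 < OversampledWavelet.dilationSquareSum a (OversampledWavelet.truncation K ψ) γ) ∧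
        -- the dual generator is a function in `L²(ℝ)`
        ∃ ψd : OversampledWavelet.L2R,
          (𝓕 ψd : OversampledWavelet.L2R) =ᵐ[volume]
            OversampledWavelet.dualGeneratorFourier a b N K ψ ∧
          OversampledWavelet.IsFrame
            (OversampledWavelet.waveletSystem a (zero_lt_one.trans ha) (b / N) ψd) ∧
          (ε < 1 → OversampledWavelet.IsFrame
            (OversampledWavelet.waveletSystem a (zero_lt_one.trans ha) (b / N) ψ)) ∧
          ∃ U W : OversampledWavelet.ell2 (ℤ × ℤ) →L[ℂ] OversampledWavelet.L2R,
            OversampledWavelet.IsSynthesisOperator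
              (OversampledWavelet.waveletSystem a (zero_lt_one.trans ha) (b / N) ψ) U ∧
            OversampledWavelet.IsSynthesisOperator
              (OversampledWavelet.waveletSystem a (zero_lt_one.trans ha) (b / N) ψd) W ∧
            ‖ContinuousLinearMap.id ℂ OversampledWavelet.L2R -
              U ∘L ContinuousLinearMap.adjoint W‖ ≤ ε := by
  have hd : OversampledWavelet.FourierDecay C σ ψ := hdecay
  refine ⟨OversampledWavelet.eventually_errorConstant_admissible hb hframe.1 hσ hε,
    fun K hK hlt hle => ⟨OversampledWavelet.existsUnique_isOversamplingFactor b K,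
      fun N hN => ⟨?_, OversampledWavelet.exists_approximate_dual ha hb hframe hC hσ hd hK hlt hle
        hN⟩⟩⟩
  filter_upwards [OversampledWavelet.dilationSquareSum_truncation_bounds ha hb hframe hC hσ hd hK
    hlt] with γ hγ
  exact ⟨OversampledWavelet.summable_of_energyDensity_ne_top hγ.1,
    lt_of_lt_of_le (by have := sub_pos.2 hlt; positivity) hγ.2.1⟩
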